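/- Let $\mathcal H_E,\mathcal H_P$ be Hilbert spaces of finite dimensions $d_E,d_P$, let $G$ (on $\mathcal H_P$), $H_E$ (on $\mathcal H_E$) and $H_{EP}$ (on $\mathcal H_E\otimes\mathcal H_P$) be Hermitian, and let $L_1,\dots,L_r$ be operators on $\mathcal H_E\otimes\mathcal H_P$. For a finite-dimensional noiseless auxiliary space $\mathcal H_A$ and a real parameter $\omega$, let $\Phi_t=\Phi_t^{(\omega)}$ be the evolution for a time $t$ of operators on $\mathcal H_E\otimes\mathcal H_P\otimes\mathcal H_A$ under the master equation $$\frac{d\rho}{dt}=-i[H_{EP},\rho]-i[\omega\tilde G,\rho]-i[\omega\tilde H_E,\rho]+\sum_{k=1}^r\Big(L_k\rho L_k^\dagger-\tfrac12\{L_k^\dagger L_k,\rho\}\Big),$$ where $\tilde G=1_E\otimes G\otimes 1_A$, $\tilde H_E=H_E\otimes 1_P\otimes 1_A$, and $H_{EP},L_k$ act trivially on $\mathcal H_A$. For an operator $X$ on $\mathcal H_E\otimes\mathcal K$ and $\phi,\phi'\in\mathcal H_E$, $\langle\phi|X|\phi'\rangle$ denotes the corresponding operator on $\mathcal K$. Assume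 that the interaction is diagonal: there is an orthonormal basis $\{\phi_i\}_{i=1}^{d_E}$ of $\mathcal H_E$ with $H_E=\sum_i h_i|\phi_i\rangle\langle\phi_i|$, $H_{EP}=\sum_i|\phi_i\rangle\langle\phi_i|\otimes\langle\phi_i|H_{EP}|\phi_i\rangle$ and $L_k=\sum_i|\phi_i\rangle\langle\phi_i|\otimes\langle\phi_i|L_k|\phi_i\rangle$ for all $k$. Let $\mathcal S^\circ$ be the complex linear span of $1_P$, $\langle\phi_i|L_k|\phi_i\rangle$, $\langle\phi_i|L_k^\dagger|\phi_i\rangle$ and $\langle\phi_i|L_k^\dagger|\phi_i\rangle\langle\phi_m|L_j|\phi_m\rangle$ (all $k,j\le r$ and $i,m\le d_E$). A quantum error correction (QEC) protocol consists of a code space in $\mathcal H_P\otimes\mathcal H_A$ (the range of an isometry, with projector $P$) and a completely positive trace-preserving map $\mathcal R$ on the operators on $\mathcal H_P\otimes\mathcal H_A$ whose outputs are supported in the code space; one round of it is $\mathcal D(X)=PXP+\mathcal R\big((1-P)X(1-P)\big)$, acting trivially on $\mathcal H_E$. The state under arbitrarily fast QEC is $\rho(t)=\lim_{n\to\infty}(\mathcal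 D\circ\Phi_{t/n})^n(\rho_0)$. The quantum Fisher information (QFI) of a differentiable family $\sigma_\omega$ of density matrices is $\mathcal F=2\sum_{\gamma_i+\gamma_j>0}|\langle\gamma_i|\partial_\omega\sigma_\omega|\gamma_j\rangle|^2/(\gamma_i+\gamma_j)$, where $\gamma_i$, $|\gamma_i\rangle$ are the eigenvalues and an orthonormal eigenbasis of $\sigma_\omega$. If $G\notin\mathcal S^\circ$, then there are a finite-dimensional $\mathcal H_A$, a QEC protocol and a unit vector $\psi$ in its code space, none of them depending on $\omega$, $t$ or the initial state of the environment, such that: (a) (unitary joint dynamics) for every density matrix $\rho_0$ on $\mathcal H_E\otimes\mathcal H_P\otimes\mathcal H_A$ which is supported in the code space ($P\rho_0P=\rho_0$) and diagonal in the environment basis ($\rho_0=\sum_i|\phi_i\rangle\langle\phi_i|\otimes\langle\phi_i|\rho_0|\phi_i\rangle$), and for all real $\omega$ and $t\ge0$, the limit $\rho(t)$ exists and equals $e^{-itH_{\mathrm{eff}}}\rho_0e^{itH_{\mathrm{eff}}}$ with $H_{\mathrm{eff}}=P(\omega\tilde G+H_{EP})P$; (b) (QFI scaling) for every density matrix $\rho_E$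 on $\mathcal H_E$ and initial state $\rho_E\otimes|\psi\rangle\langle\psi|$, the reduced state $\sigma_\omega(t)$ of $\mathcal H_P\otimes\mathcal H_A$ under arbitrarily fast QEC exists for all $\omega$ and $t\ge0$ and is differentiable in $\omega$, and its QFI $\mathcal F(t)$ at $\omega$ satisfies $\mathcal F(t)=t^2f(t)$ for all $t\ge0$ and all $\omega$, where $f:\mathbb R\to\mathbb R$ is (Bohr) almost periodic and does not depend on $\omega$; moreover $\limsup_{t\to\infty}\mathcal F(t)/t^2>0$ for every $\omega$. -/

import Mathlib

open scoped Kronecker ComplexOrder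

noncomputable section

/-- Square complex matrices, i.e. linear operators on the Hilbert space with the standard
orthonormal basis indexed by `n`. -/
abbrev Op (n : Type) : Type := Matrix n n ℂ

/-- Basis index set of the joint space `H_E ⊗ (H_P ⊗ H_A)`. -/
abbrev EPA (dE dP dA : ℕ) : Type := Fin dE × (Fin dP × Fin dA)

/-- The data of a hidden Markov model on `H_E ⊗ H_P` with `r` jump operators. -/
structure HMM (dE dP r : ℕ) where
  /-- signal on the probe -/
  G : Op (Fin dP)
  /-- signal on the environment -/
  HE : Op (Fin dE)
  /-- unitary coupling -/
  HEP : Op (Fin dE × Fin dP)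
  /-- jump operators -/
  L : Fin r → Op (Fin dE × Fin dP)
  G_herm : G.IsHermitian
  HE_herm : HE.IsHermitian
  HEP_herm : HEP.IsHermitian

/-- `K ⊗ 1_A`, for `K` an operator on `H_E ⊗ H_P`. -/
def extendAux {dE dP : ℕ} (dA : ℕ) (K : Op (Fin dE × Fin dP)) : Op (EPA dE dP dA) :=
  Matrix.reindex (Equiv.prodAssoc _ _ _) (Equiv.prodAssoc _ _ _) (K ⊗ₖ (1 : Op (Fin dA)))

/-- `1_E ⊗ K`. -/
def onRight {S : Type} (dE : ℕ) (K : Op S) : Op (Fin dE × S) :=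
  (1 : Op (Fin dE)) ⊗ₖ K

/-- The partial trace over the environment. -/
def traceE {S : Type} {dE : ℕ} (X : Op (Fin dE × S)) : Op S :=
  Matrix.of fun s s' => ∑ e, X (e, s) (e, s')

/-- The rank one operator `|v⟩⟨v|`. -/
def ketbra {n : Type} (v : n → ℂ) : Op n := Matrix.vecMulVec v (star v)

/-- Density matrices. -/
def IsDensity {n : Type} [Fintype n] (ρ : Op n) : Prop := ρ.PosSemidef ∧ ρ.trace = 1

/-! ### Environment blocks and diagonal interactions -/

/-- The operator `⟨φ i| X |φ j⟩` on `S`, for `X` an operator on `H_E ⊗ S`. -/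
def block {S : Type} {dE : ℕ} (φ : OrthonormalBasis (Fin dE) ℂ (EuclideanSpace ℂ (Fin dE)))
    (X : Op (Fin dE × S)) (i j : Fin dE) : Op S :=
  Matrix.of fun s s' => ∑ e, ∑ e', star (φ i e) * X (e, s) (e', s') * φ j e'

/-- `X = ∑ i, |φ i⟩⟨φ i| ⊗ ⟨φ i| X |φ i⟩`. -/
def IsEnvDiagonal {S : Type} {dE : ℕ}
    (φ : OrthonormalBasis (Fin dE) ℂ (EuclideanSpace ℂ (Fin dE)))
    (X : Op (Fin dE × S)) : Prop :=
  X = ∑ i, ketbra (fun e => φ i e) ⊗ₖ block φ X i i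

/-- The hidden Markov model has a diagonal interaction with respect to the basis `φ`. -/
def HMM.IsDiagonal {dE dP r : ℕ} (M : HMM dE dP r)
    (φ : OrthonormalBasis (Fin dE) ℂ (EuclideanSpace ℂ (Fin dE))) : Prop :=
  (∃ h : Fin dE → ℝ, M.HE = ∑ i, (h i : ℂ) • ketbra (fun e => φ i e)) ∧
    IsEnvDiagonal φ M.HEP ∧ ∀ k, IsEnvDiagonal φ (M.L k)

/-- The extended Lindblad span: the complex linear span of `1`, `⟨φ i|L k|φ i⟩`,
`⟨φ i|(L k)†|φ i⟩` and `⟨φ i|(L k)†|φ i⟩⟨φ m|L j|φ m⟩`. -/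
def HMM.lindbladSpan {dE dP r : ℕ} (M : HMM dE dP r)
    (φ : OrthonormalBasis (Fin dE) ℂ (EuclideanSpace ℂ (Fin dE))) :
    Submodule ℂ (Op (Fin dP)) :=
  Submodule.span ℂ
    ({1} ∪ {X | ∃ k i, X = block φ (M.L k) i i}
      ∪ {X | ∃ k i, X = block φ (M.L k).conjTranspose i i}
      ∪ {X | ∃ k j i m, X = block φ (M.L k).conjTranspose i i * block φ (M.L j) m m})

/-! ### The master equation -/

/-- `ρ ↦ -i [K, ρ]`. -/
def hamiltonianPart {n : Type} [Fintype n] [DecidableEq n] (K : Op n) : Op n →ₗ[ℂ] Op n :=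
  (-Complex.I) • (LinearMap.mulLeft ℂ K - LinearMap.mulRight ℂ K)

/-- `ρ ↦ L ρ L† - {L† L, ρ} / 2`. -/
def dissipator {n : Type} [Fintype n] [DecidableEq n] (L : Op n) : Op n →ₗ[ℂ] Op n :=
  LinearMap.mulLeft ℂ L ∘ₗ LinearMap.mulRight ℂ L.conjTranspose
    - (1 / 2 : ℂ) • (LinearMap.mulLeft ℂ (L.conjTranspose * L)
        + LinearMap.mulRight ℂ (L.conjTranspose * L))

/-- `1_E ⊗ G ⊗ 1_A`. -/
def HMM.signalP {dE dP r : ℕ} (M : HMM dE dP r) (dA : ℕ) : Op (EPA dE dP dA) :=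
  onRight dE (M.G ⊗ₖ (1 : Op (Fin dA)))

/-- `H_E ⊗ 1_P ⊗ 1_A`. -/
def HMM.signalE {dE dP r : ℕ} (M : HMM dE dP r) (dA : ℕ) : Op (EPA dE dP dA) :=
  M.HE ⊗ₖ (1 : Op (Fin dP × Fin dA))

/-- The generator of the master equation at parameter value `ω`. -/
def HMM.generator {dE dP r : ℕ} (M : HMM dE dP r) (dA : ℕ) (ω : ℝ) :
    Op (EPA dE dP dA) →ₗ[ℂ] Op (EPA dE dP dA) :=
  hamiltonianPart (extendAux dA M.HEP)
    + hamiltonianPart ((ω : ℂ) • M.signalP dA)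
    + hamiltonianPart ((ω : ℂ) • M.signalE dA)
    + ∑ k, dissipator (extendAux dA (M.L k))

/-- The exponential of a linear map of a matrix space into itself, computed on its matrix in
the basis of matrix units. -/
def expLin {n : Type} [Fintype n] [DecidableEq n] (T : Op n →ₗ[ℂ] Op n) : Op n →ₗ[ℂ] Op n :=
  (LinearMap.toMatrixAlgEquiv (Matrix.stdBasis ℂ n n)).symm
    (NormedSpace.exp (LinearMap.toMatrixAlgEquiv (Matrix.stdBasis ℂ n n) T))

/-- The evolution channel of the master equation for a duration `t`. -/
def HMM.evolve {dE dP r : ℕ} (M : HMM dE dP r) (dA : ℕ) (ω t : ℝ) :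
    Op (EPA dE dP dA) →ₗ[ℂ] Op (EPA dE dP dA) :=
  expLin ((t : ℂ) • M.generator dA ω)

/-! ### Quantum error correction on probe and auxiliary system -/

/-- A quantum error correction protocol on `H_P ⊗ H_A`: an isometric encoding of `ℂ^d` and a
recovery channel, given by Kraus operators, which returns every state to the code space. -/
structure QECProtocol (dP dA : ℕ) where
  /-- dimension of the code space -/
  d : ℕ
  /-- the encoding isometry -/
  enc : Matrix (Fin dP × Fin dA) (Fin d) ℂ
  enc_isometry : enc.conjTranspose * enc = 1
  /-- number of Kraus operators of the recovery channel -/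
  m : ℕ
  /-- Kraus operators of the recovery channel -/
  kraus : Fin m → Op (Fin dP × Fin dA)
  kraus_tp : ∑ l, (kraus l).conjTranspose * kraus l = 1
  kraus_range : ∀ l, enc * enc.conjTranspose * kraus l = kraus l

/-- The projector onto the code space. -/
def QECProtocol.proj {dP dA : ℕ} (C : QECProtocol dP dA) : Op (Fin dP × Fin dA) :=
  C.enc * C.enc.conjTranspose

/-- The recovery channel, acting trivially on the environment. -/
def QECProtocol.recover {dP dA : ℕ} (C : QECProtocol dP dA) {dE : ℕ} (X : Op (EPA dE dP dA)) :
    Op (EPA dE dP dA) :=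
  ∑ l, onRight dE (C.kraus l) * X * (onRight dE (C.kraus l)).conjTranspose

/-- One round of error correction, acting trivially on the environment: measure `{P, 1 - P}` and
apply the recovery channel if the state is found outside the code space. -/
def QECProtocol.round {dP dA : ℕ} (C : QECProtocol dP dA) {dE : ℕ} (X : Op (EPA dE dP dA)) :
    Op (EPA dE dP dA) :=
  onRight dE C.proj * X * onRight dE C.proj
    + C.recover (onRight dE (1 - C.proj) * X * onRight dE (1 - C.proj))

/-- The joint state at time `t` when `n` equally spaced rounds of error correction are performed
during the evolution. -/
def HMM.correctedState {dE dP r dA : ℕ} (M : HMM dE dP r) (C : QECProtocol dP dA)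
    (ω t : ℝ) (ρ₀ : Op (EPA dE dP dA)) (n : ℕ) : Op (EPA dE dP dA) :=
  (fun X => C.round (M.evolve dA ω (t / n) X))^[n] ρ₀

/-- The effective Hamiltonian `P (ω 1_E ⊗ G ⊗ 1_A + H_EP ⊗ 1_A) P`. -/
def HMM.effectiveHamiltonian {dE dP r dA : ℕ} (M : HMM dE dP r) (C : QECProtocol dP dA)
    (ω : ℝ) : Op (EPA dE dP dA) :=
  onRight dE C.proj * ((ω : ℂ) • M.signalP dA + extendAux dA M.HEP) * onRight dE C.proj

/-! ### Quantum Fisher information and almost periodicity -/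

/-- The entrywise derivative of a matrix valued function of a real variable. -/
def matrixDeriv {n : Type} (ρ : ℝ → Op n) (ω : ℝ) : Op n :=
  Matrix.of fun a b => deriv (fun w => ρ w a b) ω

open Classical in
/-- The quantum Fisher information at `ω` of a (differentiable) family `ρ` of density matrices:
`2 ∑ |⟨γ i| ∂ρ |γ j⟩|² / (γ i + γ j)`, over the pairs with `γ i + γ j > 0`, where `γ i` and
`|γ i⟩` are the eigenvalues and an orthonormal eigenbasis of `ρ ω`. -/
def qfi {n : Type} [Fintype n] [DecidableEq n] (ρ : ℝ → Op n) (ω : ℝ) : ℝ :=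
  if h : (ρ ω).IsHermitian then
    2 * ∑ i, ∑ j, if 0 < h.eigenvalues i + h.eigenvalues j then
      ‖star (fun a => h.eigenvectorBasis i a) ⬝ᵥ
          (matrixDeriv ρ ω).mulVec (fun a => h.eigenvectorBasis j a)‖ ^ 2
        / (h.eigenvalues i + h.eigenvalues j)
      else 0
  else 0

/-- Almost periodic functions in the sense of Bohr: continuous, and for every `ε > 0` the
`ε`-almost periods are relatively dense. -/
def IsAlmostPeriodic (f : ℝ → ℝ) : Prop :=
  Continuous f ∧ ∀ ε > 0, ∃ l > 0, ∀ a : ℝ, ∃ τ ∈ Set.Icc a (a + l),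
    ∀ t, |f (t + τ) - f t| ≤ ε

end

/-! ### Product formulas in a Banach algebra. -/

section BanachAlgebra

open Filter Topology

/-! Dephasing the environment in the basis `φ` commutes with the master equation and with every
round of correction, and it does not change the partial trace over the environment. So only
environment-diagonal states matter, and on the branch `φ i` the jump operator `L k` acts on the
probe alone as `block φ (M.L k) i i`, while the signal `HE` is a scalar and drops out.

The span `lindbladSpan` contains the branch errors and all their products `E† F`, including products
across branches. A code on which it compresses to scalars therefore satisfies the Knill–Laflamme
conditions for all branches at once, and one recovery, ignorant of the branch, corrects everything
(`exists_corrects`). To first order in the duration of a round, correction cancels the dissipators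
and compresses the Hamiltonians to the code (`roundLin_generator`). A Zeno-type product formula
(`tendsto_pow_mul_exp_pow`) turns this into the limit `tendsto_correctedState`, which is (a).

For the code, take a Hermitian `T` that is trace-orthogonal to the span but not to `G`, and purify
the two states proportional to `(1 ± T)²` with orthogonal auxiliary supports. Their expectations
agree on the span and differ on `G` (`exists_purifications`), and every probe operator compresses to
a diagonal matrix on this qubit (`purifiedEnc_compress`). Hence each branch only rotates the phase
of the uniform superposition, at angular speed `ω g + δ i` with `g ≠ 0`. With environment
populations `p`, the coherence is `exp(-i t ω g) χ(t)`, where `χ` is `charSum p δ`. The code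
populations stay at 1/2, so the Fisher information is exactly `t² g² |χ(t)|²`
(`qfi_coherenceState`). Finally `χ` is a trigonometric polynomial with `χ(0) = 1`, so `|χ|²` is
almost periodic and keeps returning near 1. -/

lemma norm_pow_sub_pow_le {𝔸 : Type*} [NormedRing 𝔸] [NormOneClass 𝔸] {x y : 𝔸} {M : ℝ}
    (hx : ‖x‖ ≤ M) (hy : ‖y‖ ≤ M) (hM : 1 ≤ M) (n : ℕ) :
    ‖x ^ n - y ^ n‖ ≤ n * ‖x - y‖ * M ^ n := by
  induction n with
  | zero => simp
  | succ n ih =>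
    have h0 : x ^ (n + 1) - y ^ (n + 1) = (x ^ n - y ^ n) * x + y ^ n * (x - y) := by
      rw [pow_succ, pow_succ]; noncomm_ring
    have hM0 : 0 ≤ M := zero_le_one.trans hM
    have h1 : ‖(x ^ n - y ^ n) * x‖ ≤ n * ‖x - y‖ * M ^ n * M :=
      (norm_mul_le _ _).trans (mul_le_mul ih hx (norm_nonneg _) (by positivity))
    have h2 : ‖y ^ n * (x - y)‖ ≤ M ^ n * M * ‖x - y‖ := by
      refine (norm_mul_le _ _).trans (mul_le_mul_of_nonneg_right ?_ (norm_nonneg _))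
      calc ‖y ^ n‖ ≤ ‖y‖ ^ n := norm_pow_le _ _
        _ ≤ M ^ n := pow_le_pow_left₀ (norm_nonneg _) hy n
        _ ≤ M ^ n * M := le_mul_of_one_le_right (by positivity) hM
    calc ‖x ^ (n + 1) - y ^ (n + 1)‖ ≤ n * ‖x - y‖ * M ^ n * M + M ^ n * M * ‖x - y‖ := by
          rw [h0]; exact (norm_add_le _ _).trans (add_le_add h1 h2)
      _ = (n + 1 : ℕ) * ‖x - y‖ * M ^ (n + 1) := by push_cast; ring

lemma norm_le_one_add_div {𝔸 : Type*} [NormedRing 𝔸] [NormOneClass 𝔸] [NormedAlgebra ℂ 𝔸]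
    {x : 𝔸} {n : ℕ} (hn : n ≠ 0) {c : ℝ} (h : ‖(n : ℂ) • (x - 1)‖ ≤ c) : ‖x‖ ≤ 1 + c / n := by
  have hn' : (0 : ℝ) < n := by positivity
  rw [norm_smul, Complex.norm_natCast] at h
  have h1 : ‖x - 1‖ ≤ c / n := by rw [le_div_iff₀ hn']; linarith
  calc ‖x‖ = ‖1 + (x - 1)‖ := by congr 1; abel
    _ ≤ ‖(1 : 𝔸)‖ + ‖x - 1‖ := norm_add_le _ _
    _ ≤ 1 + c / n := by rw [norm_one]; linarith

lemma tendsto_smul_exp_sub_one {𝔸 : Type*} [NormedRing 𝔸] [NormedAlgebra ℂ 𝔸] [CompleteSpace 𝔸]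
    (a : 𝔸) : Tendsto (fun n : ℕ => (n : ℂ) • (NormedSpace.exp ((n : ℂ)⁻¹ • a) - 1)) atTop
      (𝓝 a) := by
  have hd : HasDerivAt (fun u : ℂ => NormedSpace.exp (u • a)) a 0 := by
    simpa using hasDerivAt_exp_smul_const (𝕂 := ℂ) a (0 : ℂ)
  have hinv : Tendsto (fun n : ℕ => (n : ℂ)⁻¹) atTop (𝓝[≠] 0) := by
    refine tendsto_nhdsWithin_iff.2 ⟨tendsto_inv_atTop_nhds_zero_nat, ?_⟩
    filter_upwards [eventually_ne_atTop 0] with n hn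
    simpa using hn
  refine (hd.tendsto_slope.comp hinv).congr fun n => ?_
  simp [slope]

/-- If `x n = 1 + a / n + o(1 / n)`, then `x n ^ n` tends to `exp a`. -/
lemma tendsto_pow_exp_of_tendsto_smul_sub_one {𝔸 : Type*} [NormedRing 𝔸] [NormOneClass 𝔸]
    [NormedAlgebra ℂ 𝔸] [CompleteSpace 𝔸] {a : 𝔸} {x : ℕ → 𝔸}
    (hx : Tendsto (fun n : ℕ => (n : ℂ) • (x n - 1)) atTop (𝓝 a)) :
    Tendsto (fun n => x n ^ n) atTop (𝓝 (NormedSpace.exp a)) := by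
  -- Compare with `y n = exp (a / n)`, whose `n`-th power is exactly `exp a`. Both sequences have
  -- the same first-order term, so `n * ‖x n - y n‖` tends to 0, and the powers occurring in the
  -- telescoped difference are bounded by `exp c`.
  set y : ℕ → 𝔸 := fun n => NormedSpace.exp ((n : ℂ)⁻¹ • a) with hydef
  have hy := tendsto_smul_exp_sub_one a
  have hyn : ∀ n : ℕ, n ≠ 0 → y n ^ n = NormedSpace.exp a := by
    intro n hn
    have hn' : (n : ℂ) ≠ 0 := by exact_mod_cast hn
    let _ : NormedAlgebra ℚ 𝔸 := NormedAlgebra.restrictScalars ℚ ℂ 𝔸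
    rw [hydef, ← NormedSpace.exp_nsmul, ← Nat.cast_smul_eq_nsmul ℂ, smul_smul,
      mul_inv_cancel₀ hn', one_smul]
  set c := ‖a‖ + 1
  have hc : ‖a‖ < c := lt_add_one _
  have hdiff : Tendsto (fun n : ℕ => (n : ℝ) * ‖x n - y n‖ * Real.exp c) atTop (𝓝 0) := by
    have h := ((hx.sub hy).norm).mul_const (Real.exp c)
    simp only [sub_self, norm_zero, zero_mul] at h
    refine h.congr fun n => ?_
    rw [← smul_sub, norm_smul, Complex.norm_natCast]
    congr 3; abel
  rw [tendsto_iff_norm_sub_tendsto_zero]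
  refine squeeze_zero' (Eventually.of_forall fun n => norm_nonneg _) ?_ hdiff
  filter_upwards [eventually_ne_atTop 0, hx.norm.eventually (gt_mem_nhds hc),
    hy.norm.eventually (gt_mem_nhds hc)] with n hn h1 h2
  have hc0 : 0 ≤ c := by positivity
  have key := norm_pow_sub_pow_le (norm_le_one_add_div hn h1.le) (norm_le_one_add_div hn h2.le)
    (le_add_of_nonneg_right (by positivity)) n
  rw [hyn n hn] at key
  refine key.trans (mul_le_mul_of_nonneg_left ?_ (by positivity))
  calc (1 + c / n) ^ n ≤ (Real.exp (c / n)) ^ n :=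
        pow_le_pow_left₀ (by positivity) (by linarith [Real.add_one_le_exp (c / n)]) n
    _ = Real.exp c := by
        rw [← Real.exp_nat_mul]; congr 1
        have : (n : ℝ) ≠ 0 := by exact_mod_cast hn
        field_simp

/-- For operators acting on the left: `a` and `b` agree on the range of `p`, and `b` maps this range
into itself, so the agreement survives iteration. -/
lemma pow_mul_eq_pow_mul {R : Type*} [Monoid R] {a b p : R} (hpp : p * p = p)
    (hab : a * p = b * p) (hb : p * (b * p) = b * p) (n : ℕ) :
    a ^ n * p = b ^ n * p ∧ p * (b ^ n * p) = b ^ n * p := by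
  induction n with
  | zero => simp [hpp]
  | succ n ih =>
    have h : b ^ (n + 1) * p = b * p * (b ^ n * p) := by
      rw [mul_assoc b, ih.2, pow_succ', mul_assoc]
    refine ⟨?_, by rw [h, ← mul_assoc, hb]⟩
    rw [h, pow_succ', mul_assoc, ih.1, ← hab, mul_assoc a, ih.2]

lemma exp_mul_eq_exp_mul {𝔸 : Type*} [NormedRing 𝔸] [NormedAlgebra ℂ 𝔸] [CompleteSpace 𝔸]
    {a b p : 𝔸} (hpp : p * p = p) (hab : a * p = b * p) (hb : p * (b * p) = b * p) :
    NormedSpace.exp a * p = NormedSpace.exp b * p := by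
  have h1 := (NormedSpace.exp_series_hasSum_exp' (𝕂 := ℂ) a).mul_right p
  have h2 := (NormedSpace.exp_series_hasSum_exp' (𝕂 := ℂ) b).mul_right p
  simp only [smul_mul_assoc, (pow_mul_eq_pow_mul hpp hab hb _).1] at h1 h2
  exact h1.unique h2

/-- A product formula: rapid repetition of a map `d`, which projects onto the range of `p`, during
the evolution generated by `l` restricts the generator to the range of `p`. -/
lemma tendsto_pow_mul_exp_pow {𝔸 : Type*} [NormedRing 𝔸] [NormOneClass 𝔸]
    [NormedAlgebra ℂ 𝔸] [CompleteSpace 𝔸] {d l p b : 𝔸} (hpp : p * p = p) (hdp : d * p = p)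
    (hinv : ∀ s : ℂ, p * (d * NormedSpace.exp (s • l) * p) = d * NormedSpace.exp (s • l) * p)
    (hb : d * l * p = b * p) (hpb : p * (b * p) = b * p) (t : ℂ) :
    Tendsto (fun n : ℕ => (d * NormedSpace.exp ((t / n) • l)) ^ n * p) atTop
      (𝓝 (NormedSpace.exp (t • b) * p)) := by
  have hder : Tendsto (fun n : ℕ => (n : ℂ) • (NormedSpace.exp ((t / n) • l) - 1)) atTop
      (𝓝 (t • l)) := by
    refine (tendsto_smul_exp_sub_one (t • l)).congr fun n => ?_
    rw [smul_smul, div_eq_inv_mul]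
  -- The step `d * exp (t l / n)` need not be close to 1, since `d` projects. Replacing it by the
  -- identity on the complement of `p` gives an element `1 + O(1 / n)` with the same action on the
  -- range of `p`.
  set x : ℕ → 𝔸 := fun n => d * NormedSpace.exp ((t / n) • l) * p + (1 - p) with hxdef
  have hxp : ∀ n, x n * p = d * NormedSpace.exp ((t / n) • l) * p := by
    intro n
    simp only [hxdef, add_mul, sub_mul, one_mul, hpp, sub_self, add_zero, mul_assoc]
  have hx : Tendsto (fun n : ℕ => (n : ℂ) • (x n - 1)) atTop (𝓝 (t • (b * p))) := by
    have h := (hder.const_mul d).mul_const p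
    have e : d * t • l * p = t • (b * p) := by
      rw [mul_smul_comm, smul_mul_assoc, hb]
    rw [e] at h
    refine h.congr fun n => ?_
    simp only [hxdef, mul_smul_comm, smul_mul_assoc, mul_sub, sub_mul, mul_one, hdp]
    congr 1; abel
  have hlim := (tendsto_pow_exp_of_tendsto_smul_sub_one hx).mul_const p
  have e : NormedSpace.exp (t • (b * p)) * p = NormedSpace.exp (t • b) * p := by
    refine exp_mul_eq_exp_mul hpp ?_ ?_
    · rw [smul_mul_assoc, mul_assoc, hpp, smul_mul_assoc]
    · rw [smul_mul_assoc, mul_smul_comm, hpb]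
  rw [e] at hlim
  refine hlim.congr fun n => ?_
  refine ((pow_mul_eq_pow_mul hpp (hxp n).symm ?_ n).1).symm
  rw [hxp n, hinv]

end BanachAlgebra

/-! ### Exponentials of superoperators. -/

section Superoperators

open Filter Topology

variable {n : Type} [Fintype n] [DecidableEq n]

attribute [local instance] Matrix.linftyOpNormedRing Matrix.linftyOpNormedAlgebra

lemma expLin_hamiltonianPart (H X : Op n) (t : ℂ) :
    expLin (t • hamiltonianPart H) X
      = NormedSpace.exp ((-(Complex.I * t)) • H) * X * NormedSpace.exp ((Complex.I * t) • H) := by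
  set e := LinearMap.toMatrixAlgEquiv (Matrix.stdBasis ℂ n n)
  have hl : ∀ A : Op n, NormedSpace.exp (e (LinearMap.mulLeft ℂ A))
      = e (LinearMap.mulLeft ℂ (NormedSpace.exp A)) := by
    intro A
    let F : Op n →ₐ[ℂ] Matrix (n × n) (n × n) ℂ := e.toAlgHom.comp (Algebra.lmul ℂ (Op n))
    have hF : Continuous F := LinearMap.continuous_of_finiteDimensional F.toLinearMap
    exact (NormedSpace.map_exp F hF A).symm
  have hr : ∀ A : Op n, NormedSpace.exp (e (LinearMap.mulRight ℂ A))
      = e (LinearMap.mulRight ℂ (NormedSpace.exp A)) := by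
    intro A
    -- Right multiplication reverses products and so is not an algebra homomorphism; the exponential
    -- series are compared term by term, since powers of a single element are still respected.
    have hF : Continuous (e.toLinearMap ∘ₗ (LinearMap.mul ℂ (Op n)).flip) :=
      LinearMap.continuous_of_finiteDimensional _
    have h1 := (NormedSpace.exp_series_hasSum_exp' (𝕂 := ℂ) A).map _ hF
    have h2 : (e.toLinearMap ∘ₗ (LinearMap.mul ℂ (Op n)).flip) ∘
          (fun k : ℕ => ((k.factorial : ℂ)⁻¹) • A ^ k)
        = fun k : ℕ => ((k.factorial : ℂ)⁻¹) • e (LinearMap.mulRight ℂ A) ^ k := by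
      funext k
      rw [← map_pow, LinearMap.pow_mulRight]
      simp only [Function.comp_apply, map_smul]
      rfl
    rw [h2] at h1
    exact (NormedSpace.exp_series_hasSum_exp' (𝕂 := ℂ) (e (LinearMap.mulRight ℂ A))).unique h1
  have hsplit : t • hamiltonianPart H = LinearMap.mulLeft ℂ ((-(Complex.I * t)) • H)
      + LinearMap.mulRight ℂ ((Complex.I * t) • H) := by
    ext Y : 1
    simp [hamiltonianPart, sub_eq_add_neg, smul_smul, mul_comm]
  have hcomm : Commute (e (LinearMap.mulLeft ℂ ((-(Complex.I * t)) • H)))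
      (e (LinearMap.mulRight ℂ ((Complex.I * t) • H))) :=
    (LinearMap.commute_mulLeft_right _ _).map e
  have : expLin (t • hamiltonianPart H) = e.symm (NormedSpace.exp (e (t • hamiltonianPart H))) := rfl
  rw [this, hsplit, map_add, Matrix.exp_add_of_commute _ _ hcomm, hl, hr, ← map_mul,
    AlgEquiv.symm_apply_apply]
  simp [Module.End.mul_apply, mul_assoc]

lemma continuous_toMatrixAlgEquiv_symm_apply (X : Op n) :
    Continuous fun A : Matrix (n × n) (n × n) ℂ =>
      (LinearMap.toMatrixAlgEquiv (Matrix.stdBasis ℂ n n)).symm A X :=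
  LinearMap.continuous_of_finiteDimensional
    ((LinearMap.applyₗ X : (Op n →ₗ[ℂ] Op n) →ₗ[ℂ] Op n) ∘ₗ
      (LinearMap.toMatrixAlgEquiv (Matrix.stdBasis ℂ n n)).symm.toLinearMap)

lemma commute_expLin {T Q : Op n →ₗ[ℂ] Op n} (h : Q * T = T * Q) (s : ℂ) :
    Q * expLin (s • T) = expLin (s • T) * Q := by
  set e := LinearMap.toMatrixAlgEquiv (Matrix.stdBasis ℂ n n)
  have h1 : Commute (e Q) (e (s • T)) := by
    have h2 : Commute Q (s • T) := Commute.smul_right h s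
    exact h2.map e
  apply e.injective
  have := h1.exp_right
  have h3 : e (expLin (s • T)) = NormedSpace.exp (e (s • T)) := e.apply_symm_apply _
  rw [map_mul, map_mul, h3]
  exact this

/-- Rapid repetition of a map `d`, which projects onto the range of `p`, during the evolution
generated by `l` restricts the generator to the range of `p`. -/
lemma tendsto_iterate_expLin {d l p b : Op n →ₗ[ℂ] Op n} (hpp : p * p = p) (hdp : d * p = p)
    (hinv : ∀ s : ℂ, p * (d * expLin (s • l) * p) = d * expLin (s • l) * p)
    (hb : d * l * p = b * p) (hpb : p * (b * p) = b * p) (t : ℂ) {X : Op n} (hX : p X = X) :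
    Tendsto (fun k : ℕ => (fun Y => d (expLin ((t / k) • l) Y))^[k] X) atTop
      (𝓝 (expLin (t • b) X)) := by
  -- The matrix algebra has `‖1‖ = 1` only for a nonempty index type.
  rcases isEmpty_or_nonempty n with hn | hn
  · rw [show (fun k : ℕ => (fun Y => d (expLin ((t / k) • l) Y))^[k] X)
      = fun _ => expLin (t • b) X from funext fun k => Subsingleton.elim _ _]
    exact tendsto_const_nhds
  set e := LinearMap.toMatrixAlgEquiv (Matrix.stdBasis ℂ n n)
  have he : ∀ T, e (expLin T) = NormedSpace.exp (e T) := fun T => e.apply_symm_apply _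
  have h := tendsto_pow_mul_exp_pow (𝔸 := Matrix (n × n) (n × n) ℂ) (d := e d) (l := e l)
    (p := e p) (b := e b) (by rw [← map_mul, hpp]) (by rw [← map_mul, hdp])
    (fun s => by
      rw [← map_smul]
      refine (congrArg (fun z => e p * (e d * z * e p)) (he (s • l)).symm).trans
        (Eq.trans ?_ (congrArg (fun z => e d * z * e p) (he (s • l))))
      simp only [← map_mul, hinv])
    (by simp only [← map_mul, hb]) (by simp only [← map_mul, hpb]) t
  have h' := ((continuous_toMatrixAlgEquiv_symm_apply X).tendsto _).comp h
  have e1 : e.symm (NormedSpace.exp (t • e b) * e p) X = expLin (t • b) X := by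
    rw [← map_smul, ← he, ← map_mul, e.symm_apply_apply, Module.End.mul_apply, hX]
  change Tendsto _ _ (𝓝 (e.symm (NormedSpace.exp (t • e b) * e p) X)) at h'
  rw [e1] at h'
  refine h'.congr fun k => ?_
  change e.symm ((e d * NormedSpace.exp ((t / k) • e l)) ^ k * e p) X = _
  rw [← map_smul]
  refine (congrArg (fun z => e.symm ((e d * z) ^ k * e p) X) (he ((t / k) • l)).symm).trans ?_
  simp only [← map_mul, ← map_pow, e.symm_apply_apply]
  rw [Module.End.mul_apply, hX, Module.End.pow_apply]
  rfl

end Superoperators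

/-! ### Operators acting trivially on the environment. -/

section OnRight

variable {S : Type} {dE : ℕ}

lemma onRight_mul [Fintype S] (A B : Op S) : onRight dE (A * B) = onRight dE A * onRight dE B := by
  rw [onRight, onRight, onRight, ← Matrix.mul_kronecker_mul, one_mul]

lemma onRight_add (A B : Op S) : onRight dE (A + B) = onRight dE A + onRight dE B :=
  Matrix.kronecker_add _ _ _

lemma onRight_smul (c : ℂ) (A : Op S) : onRight dE (c • A) = c • onRight dE A :=
  Matrix.kronecker_smul _ _ _

lemma onRight_one [DecidableEq S] : onRight dE (1 : Op S) = 1 := Matrix.one_kronecker_one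

lemma onRight_zero : onRight dE (0 : Op S) = 0 := Matrix.kronecker_zero _

lemma onRight_sub (A B : Op S) : onRight dE (A - B) = onRight dE A - onRight dE B := by
  rw [eq_sub_iff_add_eq, ← onRight_add, sub_add_cancel]

lemma onRight_sum {ι : Type*} (s : Finset ι) (A : ι → Op S) :
    onRight dE (∑ i ∈ s, A i) = ∑ i ∈ s, onRight dE (A i) :=
  map_sum (⟨⟨onRight dE, onRight_zero⟩, onRight_add⟩ : Op S →+ Op (Fin dE × S)) A s

lemma onRight_conjTranspose (A : Op S) :
    onRight dE A.conjTranspose = (onRight dE A).conjTranspose := by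
  rw [onRight, onRight, Matrix.conjTranspose_kronecker, Matrix.conjTranspose_one]

end OnRight

/-! ### Operators acting trivially on the auxiliary space. -/

section ExtendAux

variable {dE dP : ℕ} (dA : ℕ)

lemma extendAux_mul (A B : Op (Fin dE × Fin dP)) :
    extendAux dA (A * B) = extendAux dA A * extendAux dA B := by
  simp only [extendAux, Matrix.reindex_apply]
  rw [Matrix.submatrix_mul_equiv, ← Matrix.mul_kronecker_mul, one_mul]

lemma extendAux_kronecker (A : Op (Fin dE)) (B : Op (Fin dP)) :
    extendAux dA (A ⊗ₖ B) = A ⊗ₖ (B ⊗ₖ (1 : Op (Fin dA))) :=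
  Matrix.kronecker_assoc _ _ _

end ExtendAux

/-! ### Environment branches and the dephasing map. -/

section Environment

variable {S : Type} [DecidableEq S] {dE : ℕ}
  (φ : OrthonormalBasis (Fin dE) ℂ (EuclideanSpace ℂ (Fin dE)))

lemma ketbra_mul_ketbra {n : Type} [Fintype n] (v w : n → ℂ) :
    ketbra v * ketbra w = (star v ⬝ᵥ w) • Matrix.vecMulVec v (star w) := by
  rw [ketbra, ketbra, Matrix.vecMulVec_mul_vecMulVec, Matrix.vecMulVec_smul]

lemma star_dotProduct_orthonormalBasis (i j : Fin dE) :
    star (fun e => φ i e) ⬝ᵥ (fun e => φ j e) = if i = j then 1 else 0 := by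
  rw [← orthonormal_iff_ite.1 φ.orthonormal i j, EuclideanSpace.inner_eq_star_dotProduct,
    dotProduct_comm]

lemma sum_ketbra_orthonormalBasis : ∑ i, ketbra (fun e => φ i e) = 1 := by
  set U : Op (Fin dE) := Matrix.of fun e i => φ i e with hU
  have h1 : U.conjTranspose * U = 1 := by
    ext i j
    rw [Matrix.one_apply, ← star_dotProduct_orthonormalBasis φ i j]
    rfl
  rw [← mul_eq_one_comm.1 h1]
  ext e e'
  simp [ketbra, Matrix.vecMulVec_apply, Matrix.sum_apply, Matrix.mul_apply, hU]

/-- `|φ i⟩⟨φ i| ⊗ 1`. -/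
noncomputable def envProj (S : Type) [DecidableEq S] (i : Fin dE) : Op (Fin dE × S) :=
  ketbra (fun e => φ i e) ⊗ₖ (1 : Op S)

lemma envProj_mul_envProj [Fintype S] (i j : Fin dE) :
    envProj φ S i * envProj φ S j = if i = j then envProj φ S i else 0 := by
  rw [envProj, envProj, ← Matrix.mul_kronecker_mul, ketbra_mul_ketbra,
    star_dotProduct_orthonormalBasis]
  split_ifs with h
  · subst h; simp [ketbra]
  · simp

lemma sum_envProj : ∑ i, envProj φ S i = 1 := by
  have h : ∑ i, envProj φ S i = (∑ i, ketbra (fun e => φ i e)) ⊗ₖ (1 : Op S) := by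
    ext ⟨e, s⟩ ⟨e', s'⟩
    simp [envProj, Matrix.sum_apply, Finset.sum_mul]
  rw [h, sum_ketbra_orthonormalBasis, Matrix.one_kronecker_one]

lemma envProj_conjTranspose (i : Fin dE) : (envProj φ S i).conjTranspose = envProj φ S i := by
  rw [envProj, Matrix.conjTranspose_kronecker, Matrix.conjTranspose_one, ketbra,
    Matrix.conjTranspose_vecMulVec, star_star]

variable [Fintype S]

lemma envProj_mul_onRight (i : Fin dE) (A : Op S) :
    envProj φ S i * onRight dE A = onRight dE A * envProj φ S i := by
  rw [envProj, onRight, ← Matrix.mul_kronecker_mul, ← Matrix.mul_kronecker_mul]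
  simp

lemma envProj_mul_mul_envProj (X : Op (Fin dE × S)) (i : Fin dE) :
    envProj φ S i * X * envProj φ S i = ketbra (fun e => φ i e) ⊗ₖ block φ X i i := by
  ext ⟨e, s⟩ ⟨e', s'⟩
  simp only [envProj, ketbra, block, Matrix.mul_apply, Fintype.sum_prod_type,
    Matrix.kroneckerMap_apply, Matrix.vecMulVec_apply, Matrix.one_apply, Matrix.of_apply,
    Pi.star_apply, mul_ite, ite_mul, mul_one, mul_zero, zero_mul, Finset.sum_ite_eq,
    Finset.sum_ite_eq', Finset.mem_univ, if_true, Finset.mul_sum, Finset.sum_mul]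
  rw [Finset.sum_comm]
  refine Finset.sum_congr rfl fun f _ => Finset.sum_congr rfl fun f' _ => ?_
  ring

/-- The dephasing map `X ↦ ∑ i, |φ i⟩⟨φ i| X |φ i⟩⟨φ i|` of the environment. -/
noncomputable def dephase (S : Type) [Fintype S] [DecidableEq S] :
    Op (Fin dE × S) →ₗ[ℂ] Op (Fin dE × S) :=
  ∑ i, LinearMap.mulLeft ℂ (envProj φ S i) * LinearMap.mulRight ℂ (envProj φ S i)

lemma dephase_apply (X : Op (Fin dE × S)) :
    dephase φ S X = ∑ i, envProj φ S i * X * envProj φ S i := by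
  simp [dephase, LinearMap.sum_apply, Module.End.mul_apply, mul_assoc]

/-- Diagonal states become the fixed points of an idempotent superoperator, the form in which the
product formula can use them. -/
lemma isEnvDiagonal_iff_dephase (X : Op (Fin dE × S)) :
    IsEnvDiagonal φ X ↔ dephase φ S X = X := by
  simp only [IsEnvDiagonal, dephase_apply, envProj_mul_mul_envProj, eq_comm]

variable {φ}

lemma IsEnvDiagonal.envProj_mul {X : Op (Fin dE × S)} (hX : IsEnvDiagonal φ X) (i : Fin dE) :
    envProj φ S i * X = envProj φ S i * X * envProj φ S i := by
  conv_lhs => rw [← (isEnvDiagonal_iff_dephase φ X).1 hX, dephase_apply, Finset.mul_sum]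
  simp [← mul_assoc, envProj_mul_envProj, ite_mul, Finset.sum_ite_eq]

lemma IsEnvDiagonal.mul_envProj {X : Op (Fin dE × S)} (hX : IsEnvDiagonal φ X) (i : Fin dE) :
    X * envProj φ S i = envProj φ S i * X * envProj φ S i := by
  conv_lhs => rw [← (isEnvDiagonal_iff_dephase φ X).1 hX, dephase_apply, Finset.sum_mul]
  simp [mul_assoc, envProj_mul_envProj]

lemma IsEnvDiagonal.commute {X : Op (Fin dE × S)} (hX : IsEnvDiagonal φ X) (i : Fin dE) :
    Commute (envProj φ S i) X :=
  (hX.envProj_mul i).trans (hX.mul_envProj i).symm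

lemma isEnvDiagonal_of_commute {X : Op (Fin dE × S)} (h : ∀ i, Commute (envProj φ S i) X) :
    IsEnvDiagonal φ X := by
  rw [isEnvDiagonal_iff_dephase, dephase_apply]
  simp only [(h _).eq, mul_assoc, envProj_mul_envProj, if_true]
  rw [← Finset.mul_sum, sum_envProj, mul_one]

lemma commute_dephase_mulLeft {K : Op (Fin dE × S)} (hK : ∀ i, Commute (envProj φ S i) K) :
    Commute (dephase φ S) (LinearMap.mulLeft ℂ K) := by
  refine LinearMap.ext fun X => ?_
  simp only [Module.End.mul_apply, dephase_apply, LinearMap.mulLeft_apply, Finset.mul_sum]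
  refine Finset.sum_congr rfl fun i _ => ?_
  rw [← mul_assoc, (hK i).eq]; simp only [mul_assoc]

lemma commute_dephase_mulRight {K : Op (Fin dE × S)} (hK : ∀ i, Commute (envProj φ S i) K) :
    Commute (dephase φ S) (LinearMap.mulRight ℂ K) := by
  refine LinearMap.ext fun X => ?_
  simp only [Module.End.mul_apply, dephase_apply, LinearMap.mulRight_apply, Finset.sum_mul]
  refine Finset.sum_congr rfl fun i _ => ?_
  rw [mul_assoc _ _ K, (hK i).eq]; simp only [mul_assoc]

lemma dephase_mul_dephase : dephase φ S * dephase φ S = dephase φ S := by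
  refine LinearMap.ext fun X => ?_
  rw [Module.End.mul_apply, ← isEnvDiagonal_iff_dephase]
  refine isEnvDiagonal_of_commute fun i => ?_
  rw [commute_iff_eq, dephase_apply, Finset.mul_sum, Finset.sum_mul]
  simp [mul_assoc, envProj_mul_envProj]
  simp [← mul_assoc, envProj_mul_envProj]

lemma commute_dephase_hamiltonianPart {K : Op (Fin dE × S)}
    (hK : ∀ i, Commute (envProj φ S i) K) : Commute (dephase φ S) (hamiltonianPart K) :=
  ((commute_dephase_mulLeft hK).sub_right (commute_dephase_mulRight hK)).smul_right _

lemma commute_envProj_conjTranspose {K : Op (Fin dE × S)}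
    (hK : ∀ i, Commute (envProj φ S i) K) (i : Fin dE) :
    Commute (envProj φ S i) K.conjTranspose := by
  have := congrArg Matrix.conjTranspose (hK i).eq
  rw [Matrix.conjTranspose_mul, Matrix.conjTranspose_mul, envProj_conjTranspose] at this
  exact this.symm

lemma commute_dephase_dissipator {K : Op (Fin dE × S)}
    (hK : ∀ i, Commute (envProj φ S i) K) : Commute (dephase φ S) (dissipator K) := by
  have hK' := commute_envProj_conjTranspose hK
  have h2 : ∀ i, Commute (envProj φ S i) (K.conjTranspose * K) := fun i => (hK' i).mul_right (hK i)
  exact ((commute_dephase_mulLeft hK).mul_right (commute_dephase_mulRight hK')).sub_right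
    (((commute_dephase_mulLeft h2).add_right (commute_dephase_mulRight h2)).smul_right _)

end Environment

/-! ### The diagonal hidden Markov model, branch by branch. -/

section Diagonal

variable {dE dP r : ℕ} {φ : OrthonormalBasis (Fin dE) ℂ (EuclideanSpace ℂ (Fin dE))}

lemma extendAux_envProj (dA : ℕ) (i : Fin dE) :
    extendAux dA (envProj φ (Fin dP) i) = envProj φ (Fin dP × Fin dA) i := by
  rw [envProj, extendAux_kronecker, Matrix.one_kronecker_one, envProj]

lemma IsEnvDiagonal.commute_extendAux {X : Op (Fin dE × Fin dP)} (hX : IsEnvDiagonal φ X) (dA : ℕ)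
    (i : Fin dE) : Commute (envProj φ (Fin dP × Fin dA) i) (extendAux dA X) := by
  rw [← extendAux_envProj, commute_iff_eq, ← extendAux_mul, ← extendAux_mul, (hX.commute i).eq]

/-- On a single branch a joint operator may be traded for a probe operator that ignores the
environment; this is how the errors reach the scope of a code on probe and auxiliary system. -/
lemma IsEnvDiagonal.extendAux_mul_envProj {X : Op (Fin dE × Fin dP)} (hX : IsEnvDiagonal φ X)
    (dA : ℕ) (i : Fin dE) : extendAux dA X * envProj φ (Fin dP × Fin dA) i
      = onRight dE (block φ X i i ⊗ₖ (1 : Op (Fin dA))) * envProj φ (Fin dP × Fin dA) i := by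
  rw [← extendAux_envProj, ← extendAux_mul, hX.mul_envProj, envProj_mul_mul_envProj,
    extendAux_kronecker, extendAux_envProj, envProj, onRight, ← Matrix.mul_kronecker_mul, one_mul,
    mul_one]

lemma commute_envProj_signalP (M : HMM dE dP r) (dA : ℕ) (i : Fin dE) :
    Commute (envProj φ (Fin dP × Fin dA) i) (M.signalP dA) :=
  envProj_mul_onRight φ i _

lemma HMM.IsDiagonal.exists_signalE_mul_envProj {M : HMM dE dP r} (hM : M.IsDiagonal φ) (dA : ℕ)
    (i : Fin dE) : ∃ h : ℂ,
      M.signalE dA * envProj φ (Fin dP × Fin dA) i = h • envProj φ (Fin dP × Fin dA) i ∧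
      envProj φ (Fin dP × Fin dA) i * M.signalE dA = h • envProj φ (Fin dP × Fin dA) i := by
  obtain ⟨h, hh⟩ := hM.1
  have hk : ∀ j k, ketbra (fun e => φ j e) * ketbra (fun e => φ k e)
      = if j = k then ketbra (fun e => φ k e) else 0 := by
    intro j k
    rw [ketbra_mul_ketbra, star_dotProduct_orthonormalBasis]
    split_ifs with hjk
    · rw [one_smul, hjk]; rfl
    · rw [zero_smul]
  have h1 : M.HE * ketbra (fun e => φ i e) = (h i : ℂ) • ketbra (fun e => φ i e) := by
    simp only [hh, Finset.sum_mul, smul_mul_assoc, hk, smul_ite, smul_zero, Finset.sum_ite_eq',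
      Finset.mem_univ, if_true]
  have h2 : ketbra (fun e => φ i e) * M.HE = (h i : ℂ) • ketbra (fun e => φ i e) := by
    simp only [hh, Finset.mul_sum, mul_smul_comm, hk, smul_ite, smul_zero, Finset.sum_ite_eq,
      Finset.mem_univ, if_true]
  refine ⟨h i, ?_, ?_⟩
  · rw [HMM.signalE, envProj, ← Matrix.mul_kronecker_mul, h1, one_mul, Matrix.smul_kronecker]
  · rw [HMM.signalE, envProj, ← Matrix.mul_kronecker_mul, h2, one_mul, Matrix.smul_kronecker]

lemma HMM.IsDiagonal.commute_signalE {M : HMM dE dP r} (hM : M.IsDiagonal φ) (dA : ℕ)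
    (i : Fin dE) : Commute (envProj φ (Fin dP × Fin dA) i) (M.signalE dA) := by
  obtain ⟨h, h1, h2⟩ := hM.exists_signalE_mul_envProj dA i
  exact h2.trans h1.symm

lemma HMM.IsDiagonal.commute_signalE_of_isEnvDiagonal {M : HMM dE dP r} (hM : M.IsDiagonal φ)
    {dA : ℕ} {X : Op (EPA dE dP dA)} (hX : IsEnvDiagonal φ X) : Commute (M.signalE dA) X := by
  rw [commute_iff_eq, ← (isEnvDiagonal_iff_dephase φ X).1 hX, dephase_apply, Finset.mul_sum,
    Finset.sum_mul]
  refine Finset.sum_congr rfl fun i _ => ?_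
  obtain ⟨h, h1, h2⟩ := hM.exists_signalE_mul_envProj dA i
  rw [mul_assoc _ _ (M.signalE dA), h2, mul_assoc _ X, ← mul_assoc (M.signalE dA), h1,
    mul_smul_comm, smul_mul_assoc, mul_assoc]

lemma HMM.IsDiagonal.commute_generator {M : HMM dE dP r} (hM : M.IsDiagonal φ) (dA : ℕ) (ω : ℝ) :
    Commute (dephase φ (Fin dP × Fin dA)) (M.generator dA ω) :=
  (((commute_dephase_hamiltonianPart (hM.2.1.commute_extendAux dA)).add_right
    (commute_dephase_hamiltonianPart fun i => (commute_envProj_signalP M dA i).smul_right _)).add_right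
    (commute_dephase_hamiltonianPart fun i => (hM.commute_signalE dA i).smul_right _)).add_right
    (Commute.sum_right _ _ _ fun k _ =>
      commute_dephase_dissipator ((hM.2.2 k).commute_extendAux dA))

end Diagonal

/-! ### One round of correction, to first order. -/

section Round

variable {n : Type} [Fintype n] [DecidableEq n] {m : ℕ}

/-- Compression `X ↦ P X P`. -/
noncomputable def compress (P : Op n) : Op n →ₗ[ℂ] Op n :=
  LinearMap.mulLeft ℂ P * LinearMap.mulRight ℂ P

lemma compress_apply (P X : Op n) : compress P X = P * X * P := (mul_assoc P X P).symm

/-- One round of error correction with code projector `P` and Kraus operators `K`. -/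
noncomputable def roundMap (P : Op n) (K : Fin m → Op n) : Op n →ₗ[ℂ] Op n :=
  compress P + (∑ l, LinearMap.mulLeft ℂ (K l) * LinearMap.mulRight ℂ (K l).conjTranspose)
    * compress (1 - P)

lemma roundMap_apply (P : Op n) (K : Fin m → Op n) (X : Op n) : roundMap P K X =
    P * X * P + ∑ l, K l * ((1 - P) * X * (1 - P)) * (K l).conjTranspose := by
  simp [roundMap, compress_apply, LinearMap.sum_apply, Module.End.mul_apply, mul_assoc]

lemma hamiltonianPart_apply (H X : Op n) :
    hamiltonianPart H X = (-Complex.I) • (H * X - X * H) := rfl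

lemma dissipator_apply (A X : Op n) : dissipator A X = A * X * A.conjTranspose
    - (1 / 2 : ℂ) • (A.conjTranspose * A * X + X * (A.conjTranspose * A)) := by
  simp [dissipator, mul_assoc]

/-- Used with `E` a branch projector, to replace a jump operator by its branch. Commutation with `E`
keeps `A X` inside the branch, as the terms with `A† A` require. -/
lemma dissipator_congr {A B E X : Op n} (hAB : A * E = B * E) (hA : Commute E A)
    (hB : Commute E B) (hE : E.conjTranspose = E) (h1 : E * X = X) (h2 : X * E = X) :
    dissipator A X = dissipator B X := by
  have hAX : A * X = B * X := by rw [← h1, ← mul_assoc, hAB, mul_assoc]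
  have hs : E * A.conjTranspose = E * B.conjTranspose := by
    have := congrArg Matrix.conjTranspose hAB
    rwa [Matrix.conjTranspose_mul, Matrix.conjTranspose_mul, hE] at this
  have hXA : X * A.conjTranspose = X * B.conjTranspose := by
    rw [← h2, mul_assoc, hs, ← mul_assoc]
  have hs' : A.conjTranspose * E = B.conjTranspose * E := by
    have := congrArg Matrix.conjTranspose ((hA.eq.trans hAB).trans hB.eq.symm)
    rwa [Matrix.conjTranspose_mul, Matrix.conjTranspose_mul, hE] at this
  have hEB : E * (B * X) = B * X := by rw [← mul_assoc, hB.eq, mul_assoc, h1]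
  have hBE : (X * B.conjTranspose) * E = X * B.conjTranspose := by
    have := congrArg Matrix.conjTranspose hB.eq
    rw [Matrix.conjTranspose_mul, Matrix.conjTranspose_mul, hE] at this
    rw [mul_assoc, this, ← mul_assoc, h2]
  have h3 : A.conjTranspose * A * X = B.conjTranspose * B * X := by
    rw [mul_assoc, hAX, ← hEB, ← mul_assoc, hs', mul_assoc, hEB, mul_assoc]
  have h4 : X * (A.conjTranspose * A) = X * (B.conjTranspose * B) := by
    rw [← mul_assoc, hXA, ← hBE, mul_assoc, hA.eq, hAB, ← hB.eq, ← mul_assoc, hBE, mul_assoc]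
  rw [dissipator_apply, dissipator_apply, h3, h4, hAX, mul_assoc B, hXA, ← mul_assoc B]

variable {P X : Op n} {K : Fin m → Op n}

lemma mul_eq_self_of_compress {n : Type} [Fintype n] {P X : Op n} (hPP : P * P = P) (hX : P * X * P = X) :
    P * X = X ∧ X * P = X := by
  constructor
  · rw [← hX]; simp only [← mul_assoc, hPP]
  · rw [← hX]; simp only [mul_assoc, hPP]

lemma roundMap_of_compress (hPP : P * P = P) (hX : P * X * P = X) : roundMap P K X = X := by
  rw [roundMap_apply, hX]
  simp [sub_mul, (mul_eq_self_of_compress hPP hX).1]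

lemma compress_roundMap (hPP : P * P = P) (hP : P.conjTranspose = P) (hK : ∀ l, P * K l = K l)
    (Y : Op n) : compress P (roundMap P K Y) = roundMap P K Y := by
  have hK' : ∀ l, (K l).conjTranspose * P = (K l).conjTranspose := fun l => by
    rw [← congrArg Matrix.conjTranspose (hK l), Matrix.conjTranspose_mul, hP, mul_assoc, hPP]
  rw [roundMap_apply, compress_apply, mul_add, add_mul, Finset.mul_sum, Finset.sum_mul]
  congr 1
  · simp only [← mul_assoc, hPP]; simp only [mul_assoc, hPP]
  · refine Finset.sum_congr rfl fun l _ => ?_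
    simp only [← mul_assoc, hK]; simp only [mul_assoc, hK']

/-- A commutator with a code state has no component with both sides outside the code, so the
recovery sees nothing and only the compression remains. -/
lemma roundMap_hamiltonianPart (hPP : P * P = P) (hX : P * X * P = X) (H : Op n) :
    roundMap P K (hamiltonianPart H X) = hamiltonianPart (P * H * P) X := by
  obtain ⟨h1, h2⟩ := mul_eq_self_of_compress hPP hX
  have h3 : (1 - P) * (H * X - X * H) * (1 - P) = 0 := by
    have e1 : X * (1 - P) = 0 := by rw [mul_sub, mul_one, h2, sub_self]
    have e2 : (1 - P) * X = 0 := by rw [sub_mul, one_mul, h1, sub_self]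
    calc _ = (1 - P) * H * (X * (1 - P)) - (1 - P) * X * (H * (1 - P)) := by noncomm_ring
      _ = 0 := by rw [e1, e2, mul_zero, zero_mul, sub_self]
  rw [hamiltonianPart_apply, hamiltonianPart_apply, map_smul, roundMap_apply, h3]
  have e3 : P * (H * X - X * H) * P = P * H * P * X - X * (P * H * P) := by
    rw [mul_sub, sub_mul]
    congr 1
    · rw [mul_assoc, mul_assoc, h2, mul_assoc (P * H) P, h1, mul_assoc]
    · rw [← mul_assoc P, h1, ← mul_assoc, ← mul_assoc, h2]
  simp [e3]

/-- Under these conditions the jump term and both halves of the anticommutator return the same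
multiple `μ X`, and `μ - (μ + μ) / 2 = 0`. -/
lemma roundMap_dissipator (hPP : P * P = P) (hP : P.conjTranspose = P)
    (hK : ∑ l, (K l).conjTranspose * K l = 1) {A : Op n} {c : ℂ} (hc : P * A * P = c • P)
    {κ : Fin m → ℂ} (hκ : ∀ l, K l * ((1 - P) * A * P) = κ l • P) (hX : P * X * P = X) :
    roundMap P K (dissipator A X) = 0 := by
  obtain ⟨h1, h2⟩ := mul_eq_self_of_compress hPP hX
  have hQ : (1 - P).conjTranspose = 1 - P := by
    rw [Matrix.conjTranspose_sub, Matrix.conjTranspose_one, hP]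
  have hQQ : (1 - P) * (1 - P) = 1 - P := by
    rw [mul_sub, sub_mul, sub_mul, hPP]; simp
  have hc' : P * A.conjTranspose * P = star c • P := by
    have := congrArg Matrix.conjTranspose hc
    simpa [Matrix.conjTranspose_mul, hP, mul_assoc] using this
  have hκ' : ∀ l, P * A.conjTranspose * (1 - P) * (K l).conjTranspose = star (κ l) • P := by
    intro l
    have := congrArg Matrix.conjTranspose (hκ l)
    simpa only [Matrix.conjTranspose_mul, hP, hQ, Matrix.conjTranspose_smul, mul_assoc] using this
  -- The jump rate on the code: the part that stays in the code plus the part that each Kraus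
  -- operator brings back. Inserting `P + (1 - P)` and then `∑ K† K = 1` between `A†` and `A` shows
  -- that it is also the compression of `A† A`.
  set μ : ℂ := star c * c + ∑ l, star (κ l) * κ l with hμ
  have hAA : P * (A.conjTranspose * A) * P = μ • P := by
    have e1 : P * (A.conjTranspose * A) * P = P * A.conjTranspose * P * (P * A * P)
        + P * A.conjTranspose * (1 - P) * ((1 - P) * A * P) := by
      have : P * A.conjTranspose * P * (P * A * P)
          + P * A.conjTranspose * (1 - P) * ((1 - P) * A * P)
          = P * A.conjTranspose * (P * P + (1 - P) * (1 - P)) * (A * P) := by noncomm_ring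
      rw [this, hPP, hQQ, add_sub_cancel, mul_one]; noncomm_ring
    have e2 : P * A.conjTranspose * (1 - P) * ((1 - P) * A * P)
        = ∑ l, (star (κ l) * κ l) • P := by
      calc _ = P * A.conjTranspose * (1 - P) * (∑ l, (K l).conjTranspose * K l)
            * ((1 - P) * A * P) := by rw [hK, mul_one]
        _ = ∑ l, (P * A.conjTranspose * (1 - P) * (K l).conjTranspose)
            * (K l * ((1 - P) * A * P)) := by
          rw [Finset.mul_sum, Finset.sum_mul]
          exact Finset.sum_congr rfl fun l _ => by simp only [mul_assoc]
        _ = _ := Finset.sum_congr rfl fun l _ => by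
          rw [hκ', hκ, smul_mul_smul_comm, hPP]
    rw [e1, e2, hc, hc', smul_mul_smul_comm, hPP, ← Finset.sum_smul, ← add_smul]
  have e1 : X * (1 - P) = 0 := by rw [mul_sub, mul_one, h2, sub_self]
  have e2 : (1 - P) * X = 0 := by rw [sub_mul, one_mul, h1, sub_self]
  have r1 : roundMap P K (A.conjTranspose * A * X) = μ • X := by
    have : (1 - P) * (A.conjTranspose * A * X) * (1 - P) = 0 := by
      rw [mul_assoc, mul_assoc (A.conjTranspose * A), e1]; simp
    rw [roundMap_apply, this]
    simp only [mul_zero, zero_mul, Finset.sum_const_zero, add_zero]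
    calc _ = P * (A.conjTranspose * A) * (P * X * P) := by rw [hX]; simp only [mul_assoc, h2]
      _ = _ := by rw [← mul_assoc, ← mul_assoc, hAA, mul_assoc, smul_mul_assoc, ← mul_assoc, hX]
  have r2 : roundMap P K (X * (A.conjTranspose * A)) = μ • X := by
    have : (1 - P) * (X * (A.conjTranspose * A)) * (1 - P) = 0 := by
      rw [← mul_assoc, e2]; simp
    rw [roundMap_apply, this]
    simp only [mul_zero, zero_mul, Finset.sum_const_zero, add_zero]
    calc _ = (P * X * P) * (A.conjTranspose * A) * P := by rw [hX, ← mul_assoc P, h1]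
      _ = P * X * (P * (A.conjTranspose * A) * P) := by simp only [mul_assoc]
      _ = _ := by rw [hAA, mul_smul_comm, hX]
  have r3 : roundMap P K (A * X * A.conjTranspose) = μ • X := by
    rw [roundMap_apply, hμ, add_smul, Finset.sum_smul]
    congr 1
    · calc _ = (P * A * P) * X * (P * A.conjTranspose * P) := by
            conv_lhs => rw [← hX]
            simp only [mul_assoc]
        _ = _ := by
          rw [hc, hc', smul_mul_assoc, smul_mul_assoc, h1, mul_smul_comm, h2, smul_smul, mul_comm]
    · refine Finset.sum_congr rfl fun l _ => ?_
      calc _ = (K l * ((1 - P) * A * P)) * X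
            * (P * A.conjTranspose * (1 - P) * (K l).conjTranspose) := by
            conv_lhs => rw [← hX]
            simp only [mul_assoc]
        _ = _ := by
          rw [hκ, hκ', smul_mul_assoc, smul_mul_assoc, h1, mul_smul_comm, h2, smul_smul, mul_comm]
  rw [dissipator_apply, map_sub, map_smul, map_add, r1, r2, r3, ← two_smul ℂ, smul_smul]
  norm_num

end Round

/-! ### The limit of arbitrarily fast correction. -/

section CorrectedDynamics

open Filter Topology

variable {dE dP dA r : ℕ} {φ : OrthonormalBasis (Fin dE) ℂ (EuclideanSpace ℂ (Fin dE))}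

/-- The error `A` acts trivially on the code space of `C` after one round of correction. -/
def QECProtocol.Corrects (C : QECProtocol dP dA) (A : Op (Fin dP × Fin dA)) : Prop :=
  (∃ c : ℂ, C.proj * A * C.proj = c • C.proj) ∧
    ∀ l, ∃ κ : ℂ, C.kraus l * ((1 - C.proj) * A * C.proj) = κ • C.proj

lemma QECProtocol.proj_mul_proj (C : QECProtocol dP dA) : C.proj * C.proj = C.proj := by
  rw [QECProtocol.proj, Matrix.mul_assoc, ← Matrix.mul_assoc C.enc.conjTranspose,
    C.enc_isometry, Matrix.one_mul]

lemma QECProtocol.proj_conjTranspose (C : QECProtocol dP dA) :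
    C.proj.conjTranspose = C.proj := by
  rw [QECProtocol.proj, Matrix.conjTranspose_mul, Matrix.conjTranspose_conjTranspose]

/-- `QECProtocol.round` as a linear map. -/
noncomputable def QECProtocol.roundLin (C : QECProtocol dP dA) (dE : ℕ) :
    Op (EPA dE dP dA) →ₗ[ℂ] Op (EPA dE dP dA) :=
  roundMap (onRight dE C.proj) fun l => onRight dE (C.kraus l)

lemma QECProtocol.roundLin_apply (C : QECProtocol dP dA) (X : Op (EPA dE dP dA)) :
    C.roundLin dE X = C.round X := by
  rw [roundLin, roundMap_apply, round, recover, onRight_sub, onRight_one]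

lemma QECProtocol.onRight_proj_mul (C : QECProtocol dP dA) :
    onRight dE C.proj * onRight dE C.proj = onRight dE C.proj := by
  rw [← onRight_mul, C.proj_mul_proj]

lemma QECProtocol.onRight_proj_conjTranspose (C : QECProtocol dP dA) :
    (onRight dE C.proj).conjTranspose = onRight dE C.proj := by
  rw [← onRight_conjTranspose, C.proj_conjTranspose]

lemma QECProtocol.compress_mul_roundLin (C : QECProtocol dP dA) :
    compress (onRight dE C.proj) * C.roundLin dE = C.roundLin dE :=
  LinearMap.ext fun Y => compress_roundMap C.onRight_proj_mul C.onRight_proj_conjTranspose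
    (fun l => by rw [← onRight_mul, QECProtocol.proj, C.kraus_range]) Y

lemma commute_dephase_compress (C : QECProtocol dP dA) :
    Commute (dephase φ (Fin dP × Fin dA)) (compress (onRight dE C.proj)) :=
  (commute_dephase_mulLeft fun i => envProj_mul_onRight φ i _).mul_right
    (commute_dephase_mulRight fun i => envProj_mul_onRight φ i _)

lemma commute_dephase_roundLin (C : QECProtocol dP dA) :
    Commute (dephase φ (Fin dP × Fin dA)) (C.roundLin dE) := by
  refine (commute_dephase_compress C).add_right (Commute.mul_right (Commute.sum_right _ _ _
    fun l _ => ?_) ?_)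
  · refine (commute_dephase_mulLeft fun i => envProj_mul_onRight φ i _).mul_right
      (commute_dephase_mulRight fun i => ?_)
    rw [← onRight_conjTranspose]
    exact envProj_mul_onRight φ i _
  · have h : ∀ i, Commute (envProj φ (Fin dP × Fin dA) i) (1 - onRight dE C.proj) :=
      fun i => (Commute.one_right _).sub_right (envProj_mul_onRight φ i _)
    exact (commute_dephase_mulLeft h).mul_right (commute_dephase_mulRight h)

lemma commute_dephase_step {M : HMM dE dP r} (hM : M.IsDiagonal φ) (C : QECProtocol dP dA)
    (ω t : ℝ) : Commute (dephase φ (Fin dP × Fin dA)) (C.roundLin dE * M.evolve dA ω t) :=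
  (commute_dephase_roundLin C).mul_right (commute_expLin (hM.commute_generator dA ω) t)

lemma QECProtocol.Corrects.roundLin_dissipator {C : QECProtocol dP dA}
    {A : Op (Fin dP × Fin dA)} (hA : C.Corrects A) {X : Op (EPA dE dP dA)}
    (hX : onRight dE C.proj * X * onRight dE C.proj = X) :
    C.roundLin dE (dissipator (onRight dE A) X) = 0 := by
  obtain ⟨⟨c, hc⟩, h⟩ := hA
  choose κ hκ using h
  refine roundMap_dissipator C.onRight_proj_mul C.onRight_proj_conjTranspose (c := c) (κ := κ)
    ?_ ?_ ?_ hX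
  · simp only [← onRight_conjTranspose, ← onRight_mul, ← onRight_sum, C.kraus_tp, onRight_one]
  · rw [← onRight_mul, ← onRight_mul, hc, onRight_smul]
  · intro l
    rw [← onRight_one, ← onRight_sub, ← onRight_mul, ← onRight_mul, ← onRight_mul, hκ,
      onRight_smul]

/-- A diagonal state is the sum of its branches `E X E`, each still in the code because `E` commutes
with the code projector. On each of them the error is the corrected probe operator. -/
lemma roundLin_dissipator_extendAux {L : Op (Fin dE × Fin dP)} (hL : IsEnvDiagonal φ L)
    {C : QECProtocol dP dA} (hC : ∀ i, C.Corrects (block φ L i i ⊗ₖ (1 : Op (Fin dA))))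
    {X : Op (EPA dE dP dA)} (hd : IsEnvDiagonal φ X)
    (hX : onRight dE C.proj * X * onRight dE C.proj = X) :
    C.roundLin dE (dissipator (extendAux dA L) X) = 0 := by
  rw [← (isEnvDiagonal_iff_dephase φ X).1 hd, dephase_apply, map_sum, map_sum]
  refine Finset.sum_eq_zero fun i _ => ?_
  set E := envProj φ (Fin dP × Fin dA) i
  have hEE : E * E = E := by rw [envProj_mul_envProj, if_pos rfl]
  rw [dissipator_congr (hL.extendAux_mul_envProj dA i) (hL.commute_extendAux dA i)
    (envProj_mul_onRight φ i _) (envProj_conjTranspose φ i)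
    (by simp only [← mul_assoc]; rw [hEE]) (by simp only [mul_assoc]; rw [hEE])]
  refine (hC i).roundLin_dissipator ?_
  have hc : E * onRight dE C.proj = onRight dE C.proj * E := envProj_mul_onRight φ i _
  calc _ = (onRight dE C.proj * E) * X * (E * onRight dE C.proj) := by simp only [mul_assoc]
    _ = E * (onRight dE C.proj * X * onRight dE C.proj) * E := by
      rw [hc, ← hc]; simp only [mul_assoc]; rw [hc]
    _ = _ := by rw [hX]

/-- The infinitesimal form of (a): the environment signal commutes with diagonal states, the
dissipators are corrected away, and the other two Hamiltonians are compressed to the code. -/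
lemma roundLin_generator {M : HMM dE dP r} (hM : M.IsDiagonal φ) {C : QECProtocol dP dA}
    (hC : ∀ k i, C.Corrects (block φ (M.L k) i i ⊗ₖ (1 : Op (Fin dA)))) (ω : ℝ)
    {X : Op (EPA dE dP dA)} (hd : IsEnvDiagonal φ X)
    (hX : onRight dE C.proj * X * onRight dE C.proj = X) :
    C.roundLin dE (M.generator dA ω X) = hamiltonianPart (M.effectiveHamiltonian C ω) X := by
  have h1 : hamiltonianPart ((ω : ℂ) • M.signalE dA) X = 0 := by
    rw [hamiltonianPart_apply, smul_mul_assoc, mul_smul_comm,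
      (hM.commute_signalE_of_isEnvDiagonal hd).eq, sub_self, smul_zero]
  have h2 : (∑ k, dissipator (extendAux dA (M.L k))) X = ∑ k, dissipator (extendAux dA (M.L k)) X :=
    LinearMap.sum_apply _ _ _
  rw [HMM.generator, LinearMap.add_apply, LinearMap.add_apply, LinearMap.add_apply, h1, h2,
    add_zero, map_add, map_sum,
    Finset.sum_eq_zero fun k _ => roundLin_dissipator_extendAux (hM.2.2 k) (hC k) hd hX, add_zero,
    map_add, QECProtocol.roundLin, roundMap_hamiltonianPart C.onRight_proj_mul hX,
    roundMap_hamiltonianPart C.onRight_proj_mul hX, HMM.effectiveHamiltonian]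
  simp only [hamiltonianPart_apply, ← smul_add, mul_add, add_mul]
  congr 1; abel

/-- `tendsto_iterate_expLin` for the product `q * δ` of commuting idempotents, where `d` projects
into the range of `q` and `δ` commutes with the dynamics. -/
lemma tendsto_iterate_expLin_of_commute {n : Type} [Fintype n] [DecidableEq n]
    {d l q δ b : Op n →ₗ[ℂ] Op n} (hδδ : δ * δ = δ) (hqq : q * q = q) (hδq : Commute δ q)
    (hδd : Commute δ d) (hδl : Commute δ l) (hqd : q * d = d) (hdq : d * q = q)
    (hb : ∀ X, δ X = X → q X = X → d (l X) = b X) (t : ℂ) {X : Op n} (hδX : δ X = X)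
    (hqX : q X = X) :
    Tendsto (fun k : ℕ => (fun Y => d (expLin ((t / k) • l) Y))^[k] X) atTop
      (𝓝 (expLin (t • b) X)) := by
  have hδp : δ * (q * δ) = q * δ := by rw [← mul_assoc, hδq.eq, mul_assoc, hδδ]
  have hqp : q * (q * δ) = q * δ := by rw [← mul_assoc, hqq]
  have hinv : ∀ T, Commute δ T → q * δ * (d * T * (q * δ)) = d * T * (q * δ) := by
    intro T hT
    calc _ = q * (δ * d) * T * (q * δ) := by simp only [mul_assoc]
      _ = (q * d) * (δ * T) * (q * δ) := by rw [hδd.eq]; simp only [mul_assoc]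
      _ = d * T * (δ * (q * δ)) := by rw [hqd, hT.eq]; simp only [mul_assoc]
      _ = _ := by rw [hδp]
  have hb' : d * l * (q * δ) = b * (q * δ) :=
    LinearMap.ext fun Y => hb _ (LinearMap.congr_fun hδp Y) (LinearMap.congr_fun hqp Y)
  refine tendsto_iterate_expLin (p := q * δ) ?_ ?_ (fun s => hinv _ (commute_expLin hδl s)) hb' ?_ t ?_
  · rw [mul_assoc, hδp, hqp]
  · rw [← mul_assoc, hdq]
  · rw [← hb']; exact hinv _ hδl
  · rw [Module.End.mul_apply, hδX, hqX]

theorem tendsto_correctedState {M : HMM dE dP r} (hM : M.IsDiagonal φ) {C : QECProtocol dP dA}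
    (hC : ∀ k i, C.Corrects (block φ (M.L k) i i ⊗ₖ (1 : Op (Fin dA))))
    {ρ : Op (EPA dE dP dA)} (hd : IsEnvDiagonal φ ρ)
    (hρ : onRight dE C.proj * ρ * onRight dE C.proj = ρ) (ω t : ℝ) :
    Tendsto (M.correctedState C ω t ρ) atTop
      (𝓝 (NormedSpace.exp ((-(Complex.I * t)) • M.effectiveHamiltonian C ω) * ρ
        * NormedSpace.exp ((Complex.I * t) • M.effectiveHamiltonian C ω))) := by
  have hQQ : compress (onRight dE C.proj) * compress (onRight dE C.proj)
      = compress (onRight dE C.proj) := by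
    refine LinearMap.ext fun Y => ?_
    simp only [Module.End.mul_apply, compress_apply]
    simp only [← mul_assoc, C.onRight_proj_mul]
    simp only [mul_assoc, C.onRight_proj_mul]
  have hdQ : C.roundLin dE * compress (onRight dE C.proj) = compress (onRight dE C.proj) := by
    refine LinearMap.ext fun Y => ?_
    rw [Module.End.mul_apply, QECProtocol.roundLin]
    refine roundMap_of_compress C.onRight_proj_mul ?_
    rw [← compress_apply]
    exact LinearMap.congr_fun hQQ Y
  have hmain := tendsto_iterate_expLin_of_commute (d := C.roundLin dE) (l := M.generator dA ω)
    (b := hamiltonianPart (M.effectiveHamiltonian C ω)) dephase_mul_dephase hQQ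
    (commute_dephase_compress (φ := φ) C) (commute_dephase_roundLin C)
    (hM.commute_generator dA ω) C.compress_mul_roundLin hdQ
    (fun X h1 h2 => roundLin_generator hM hC ω ((isEnvDiagonal_iff_dephase φ X).2 h1)
      (by rwa [compress_apply] at h2)) t ((isEnvDiagonal_iff_dephase φ ρ).1 hd)
    (by rwa [compress_apply])
  rw [expLin_hamiltonianPart] at hmain
  refine hmain.congr fun k => ?_
  rw [HMM.correctedState]
  congr 1
  funext Y
  rw [C.roundLin_apply, HMM.evolve, Complex.ofReal_div, Complex.ofReal_natCast]

/-- Allows an initial environment state with coherences to be replaced by its dephased version when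
only the reduced state matters. -/
lemma dephase_correctedState {M : HMM dE dP r} (hM : M.IsDiagonal φ) (C : QECProtocol dP dA)
    (ω t : ℝ) (ρ : Op (EPA dE dP dA)) (k : ℕ) :
    dephase φ _ (M.correctedState C ω t ρ k) = M.correctedState C ω t (dephase φ _ ρ) k := by
  have h : ∀ Y, M.correctedState C ω t Y k = ((C.roundLin dE * M.evolve dA ω (t / k)) ^ k) Y := by
    intro Y
    rw [Module.End.pow_apply, HMM.correctedState]
    congr 1
    funext Z
    rw [Module.End.mul_apply, C.roundLin_apply]
  rw [h, h]
  exact LinearMap.congr_fun ((commute_dephase_step hM C ω (t / k)).pow_right k).eq ρ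

end CorrectedDynamics

/-! ### Recovery channels from the Knill–Laflamme conditions. -/

section Recovery

open Matrix

variable {S : Type} [Fintype S] {d : ℕ}

lemma exists_smul_one_of_mem_span {ι : Type*} {W : ι → Matrix S (Fin d) ℂ}
    (hW : ∀ l l', ∃ c : ℂ, (W l)ᴴ * W l' = c • (1 : Op (Fin d))) {A B : Matrix S (Fin d) ℂ}
    (hA : A ∈ Submodule.span ℂ (Set.range W)) (hB : B ∈ Submodule.span ℂ (Set.range W)) :
    ∃ c : ℂ, Aᴴ * B = c • (1 : Op (Fin d)) := by
  induction hA using Submodule.span_induction with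
  | mem A hA =>
    obtain ⟨l, rfl⟩ := hA
    induction hB using Submodule.span_induction with
    | mem B hB => obtain ⟨l', rfl⟩ := hB; exact hW l l'
    | zero => exact ⟨0, by simp⟩
    | add x y _ _ hx hy =>
      obtain ⟨a, ha⟩ := hx
      obtain ⟨b, hb⟩ := hy
      exact ⟨a + b, by rw [Matrix.mul_add, ha, hb, add_smul]⟩
    | smul z x _ hx =>
      obtain ⟨a, ha⟩ := hx
      exact ⟨z * a, by rw [Matrix.mul_smul, ha, smul_smul]⟩
  | zero => exact ⟨0, by simp⟩
  | add x y _ _ hx hy =>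
    obtain ⟨a, ha⟩ := hx
    obtain ⟨b, hb⟩ := hy
    exact ⟨a + b, by rw [conjTranspose_add, Matrix.add_mul, ha, hb, add_smul]⟩
  | smul z x _ hx =>
    obtain ⟨a, ha⟩ := hx
    exact ⟨star z * a, by rw [conjTranspose_smul, Matrix.smul_mul, ha, smul_smul]⟩

/-- The first column of a matrix, as a vector of the Euclidean space. -/
noncomputable def firstCol (S : Type) (d : ℕ) [NeZero d] :
    Matrix S (Fin d) ℂ →ₗ[ℂ] EuclideanSpace ℂ S where
  toFun A := WithLp.toLp 2 fun s => A s 0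
  map_add' _ _ := rfl
  map_smul' _ _ := rfl

lemma inner_firstCol [NeZero d] (A B : Matrix S (Fin d) ℂ) :
    inner ℂ (firstCol S d A) (firstCol S d B) = (Aᴴ * B) 0 0 := by
  rw [PiLp.inner_apply, Matrix.mul_apply]
  exact Finset.sum_congr rfl fun s _ => mul_comm _ _

/-- Errors satisfying the Knill–Laflamme conditions are combinations of isometries with
orthogonal ranges. -/
lemma exists_orthogonal_isometries [NeZero d] {ι : Type*} {W : ι → Matrix S (Fin d) ℂ}
    (hW : ∀ l l', ∃ c : ℂ, (W l)ᴴ * W l' = c • (1 : Op (Fin d))) :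
    ∃ (q : ℕ) (V : Fin q → Matrix S (Fin d) ℂ),
      (∀ s t, (V s)ᴴ * V t = if s = t then 1 else 0) ∧
      ∀ l, ∃ c : Fin q → ℂ, W l = ∑ s, c s • V s := by
  set 𝒲 := Submodule.span ℂ (Set.range W)
  let U := 𝒲.map (firstCol S d)
  let b := stdOrthonormalBasis ℂ U
  have hb : ∀ s, ∃ A ∈ 𝒲, firstCol S d A = b s := fun s => (b s).2
  choose V hV hVb using hb
  -- The scalar in `Aᴴ * B` is its `(0, 0)` entry, hence an inner product of first columns. An
  -- orthonormal basis of the space of first columns thus lifts to isometries with orthogonal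
  -- ranges.
  have hcoef : ∀ {A B}, A ∈ 𝒲 → B ∈ 𝒲 →
      Aᴴ * B = inner ℂ (firstCol S d A) (firstCol S d B) • (1 : Op (Fin d)) := by
    intro A B hA hB
    obtain ⟨c, hc⟩ := exists_smul_one_of_mem_span hW hA hB
    rw [inner_firstCol, hc]; simp
  refine ⟨_, V, fun s t => ?_, fun l => ?_⟩
  · rw [hcoef (hV s) (hV t), hVb, hVb, ← Submodule.coe_inner, orthonormal_iff_ite.1 b.orthonormal]
    split_ifs <;> simp
  · have hWl : W l ∈ 𝒲 := Submodule.subset_span ⟨l, rfl⟩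
    let w : U := ⟨firstCol S d (W l), W l, hWl, rfl⟩
    refine ⟨fun s => inner ℂ (b s) w, ?_⟩
    -- The error of the expansion has vanishing first column, and `Zᴴ * Z` is a scalar read off from
    -- that column, so `Z = 0`.
    set Z := W l - ∑ s, inner ℂ (b s) w • V s with hZ
    have hZm : Z ∈ 𝒲 := 𝒲.sub_mem hWl (𝒲.sum_mem fun s _ => 𝒲.smul_mem _ (hV s))
    have hZ0 : firstCol S d Z = 0 := by
      have h := congrArg Subtype.val (b.sum_repr' w)
      rw [hZ, map_sub, map_sum, sub_eq_zero]
      simp only [map_smul, hVb]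
      simpa [w] using h.symm
    have h := hcoef hZm hZm
    rw [hZ0, inner_zero_left, zero_smul] at h
    exact sub_eq_zero.1 (conjTranspose_mul_self_eq_zero.1 h)

/-- Errors satisfying the Knill–Laflamme conditions admit a recovery channel. -/
theorem exists_recovery [DecidableEq S] [NeZero d] {ι : Type*} {W : ι → Matrix S (Fin d) ℂ}
    (hW : ∀ l l', ∃ c : ℂ, (W l)ᴴ * W l' = c • (1 : Op (Fin d))) {enc : Matrix S (Fin d) ℂ}
    (henc : encᴴ * enc = 1) :
    ∃ (m : ℕ) (K : Fin m → Op S), ∑ k, (K k)ᴴ * K k = 1 ∧ (∀ k, enc * encᴴ * K k = K k) ∧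
      ∀ k l, ∃ κ : ℂ, K k * W l = κ • enc := by
  obtain ⟨q, V, hV, hWV⟩ := exists_orthogonal_isometries hW
  obtain ⟨Q, hQ⟩ : ∃ Q : Op S, Q = 1 - ∑ s, V s * (V s)ᴴ := ⟨_, rfl⟩
  have hite : ∀ (A : Matrix S (Fin d) ℂ) (s t : Fin q),
      A * (if s = t then (1 : Op (Fin d)) else 0) = if s = t then A else 0 := by
    intro A s t
    split_ifs <;> simp
  have hQh : Qᴴ = Q := by
    simp [hQ, conjTranspose_sub, conjTranspose_sum]
  have hQV : ∀ t, Q * V t = 0 := by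
    intro t
    simp [hQ, Matrix.sub_mul, Matrix.sum_mul, Matrix.mul_assoc, hV, hite]
  have hQQ : Q * Q = Q := by
    nth_rw 2 [hQ]
    rw [Matrix.mul_sub, Matrix.mul_sum]
    simp [← Matrix.mul_assoc, hQV]
  -- One Kraus operator undoes each isometry `V s`. The others, one for each basis vector of `S`,
  -- send the complement `Q` of their ranges to the encoded vector 0, which makes the channel trace
  -- preserving.
  let K : Fin q ⊕ S → Op S := Sum.elim (fun s => enc * (V s)ᴴ)
    (fun x => enc * (Matrix.single (0 : Fin d) x (1 : ℂ) * Q))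
  have h1 : ∑ k, (K k)ᴴ * K k = 1 := by
    rw [Fintype.sum_sum_type]
    have e1 : ∀ s, (K (Sum.inl s))ᴴ * K (Sum.inl s) = V s * (V s)ᴴ := by
      intro s
      simp only [K, Sum.elim_inl, conjTranspose_mul, conjTranspose_conjTranspose]
      rw [Matrix.mul_assoc, ← Matrix.mul_assoc encᴴ, henc, Matrix.one_mul]
    have e2 : ∀ x, (K (Sum.inr x))ᴴ * K (Sum.inr x) = Q * Matrix.single x x (1 : ℂ) * Q := by
      intro x
      simp only [K, Sum.elim_inr, conjTranspose_mul, hQh, conjTranspose_single, star_one]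
      rw [Matrix.mul_assoc, ← Matrix.mul_assoc encᴴ, henc, Matrix.one_mul, ← Matrix.mul_assoc,
        Matrix.mul_assoc Q, Matrix.single_mul_single_same, one_mul]
    simp only [e1, e2]
    rw [← Matrix.sum_mul, ← Matrix.mul_sum, Matrix.sum_single_one,
      Matrix.mul_one, hQQ, hQ]
    abel
  have h2 : ∀ k, enc * encᴴ * K k = K k := by
    rintro (s | x) <;>
    · simp only [K, Sum.elim_inl, Sum.elim_inr]
      rw [← Matrix.mul_assoc, Matrix.mul_assoc enc, henc, Matrix.mul_one]
  have h3 : ∀ k l, ∃ κ : ℂ, K k * W l = κ • enc := by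
    intro k l
    obtain ⟨c, hc⟩ := hWV l
    rcases k with s | x
    · refine ⟨c s, ?_⟩
      simp [K, hc, Matrix.mul_sum, Matrix.mul_assoc, hV, hite]
    · refine ⟨0, ?_⟩
      simp [K, hc, Matrix.mul_sum, Matrix.mul_assoc, hQV]
  let f := (Fintype.equivFin (Fin q ⊕ S)).symm
  exact ⟨_, K ∘ f, (f.sum_comp fun k => (K k)ᴴ * K k).trans h1, fun k => h2 _, fun k => h3 _⟩

end Recovery

/-! ### A Hermitian witness separating the signal from the Lindblad span. -/

section Witness

open Matrix

lemma block_conjTranspose {S : Type} {dE : ℕ}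
    (φ : OrthonormalBasis (Fin dE) ℂ (EuclideanSpace ℂ (Fin dE))) (X : Op (Fin dE × S))
    (i j : Fin dE) : block φ Xᴴ i j = (block φ X j i)ᴴ := by
  ext s s'
  simp only [block, of_apply, conjTranspose_apply, star_sum, star_mul', star_star]
  rw [Finset.sum_comm]
  exact Finset.sum_congr rfl fun _ _ => Finset.sum_congr rfl fun _ _ => by ring

/-- Closure under adjoints is what allows a Hermitian witness. -/
lemma HMM.conjTranspose_mem_lindbladSpan {dE dP r : ℕ} (M : HMM dE dP r)
    (φ : OrthonormalBasis (Fin dE) ℂ (EuclideanSpace ℂ (Fin dE))) {O : Op (Fin dP)}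
    (hO : O ∈ M.lindbladSpan φ) : Oᴴ ∈ M.lindbladSpan φ := by
  induction hO using Submodule.span_induction with
  | mem O hO =>
    refine Submodule.subset_span ?_
    rcases hO with ((rfl | ⟨k, i, rfl⟩) | ⟨k, i, rfl⟩) | ⟨k, j, i, m, rfl⟩
    · exact Or.inl (Or.inl (Or.inl conjTranspose_one))
    · exact Or.inl (Or.inr ⟨k, i, (block_conjTranspose φ _ i i).symm⟩)
    · refine Or.inl (Or.inl (Or.inr ⟨k, i, ?_⟩))
      rw [block_conjTranspose, conjTranspose_conjTranspose]
    · refine Or.inr ⟨j, k, m, i, ?_⟩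
      rw [conjTranspose_mul, block_conjTranspose, block_conjTranspose, conjTranspose_conjTranspose]
  | zero => rw [conjTranspose_zero]; exact Submodule.zero_mem _
  | add x y _ _ hx hy => rw [conjTranspose_add]; exact Submodule.add_mem _ hx hy
  | smul c x _ hx => rw [conjTranspose_smul]; exact Submodule.smul_mem _ _ hx

/-- A matrix outside a self-adjoint subspace of matrices is detected by a Hermitian
matrix orthogonal to the subspace. -/
lemma exists_isHermitian_trace_ne_zero {n : Type} [Fintype n] [DecidableEq n]
    {𝒮 : Submodule ℂ (Op n)} (h𝒮 : ∀ O ∈ 𝒮, Oᴴ ∈ 𝒮) {G : Op n}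
    (hG𝒮 : G ∉ 𝒮) :
    ∃ T : Op n, T.IsHermitian ∧ (∀ O ∈ 𝒮, (O * T).trace = 0) ∧ (G * T).trace ≠ 0 := by
  obtain ⟨f, hfG, hf⟩ := Submodule.exists_le_ker_of_notMem hG𝒮
  obtain ⟨R, hR⟩ : ∃ R : Op n, ∀ O, f O = (O * R).trace := by
    refine ⟨of fun i j => f (single j i 1), fun O => ?_⟩
    conv_lhs => rw [matrix_eq_sum_single O]
    simp only [map_sum, Matrix.trace, diag_apply, Matrix.mul_apply, of_apply]
    refine Finset.sum_congr rfl fun i _ => Finset.sum_congr rfl fun j _ => ?_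
    rw [← smul_eq_mul, ← map_smul, smul_single, smul_eq_mul, mul_one]
  have hR𝒮 : ∀ O ∈ 𝒮, (O * R).trace = 0 := fun O hO => by rw [← hR]; exact hf hO
  have hstar : ∀ O : Op n, (O * Rᴴ).trace = star ((Oᴴ * R).trace) := by
    intro O
    rw [← trace_conjTranspose, conjTranspose_mul, conjTranspose_conjTranspose, trace_mul_comm]
  have hR𝒮' : ∀ O ∈ 𝒮, (O * Rᴴ).trace = 0 := fun O hO => by
    rw [hstar, hR𝒮 _ (h𝒮 O hO), star_zero]
  -- `R` is a combination of the Hermitian matrices `R + Rᴴ` and `i (R - Rᴴ)`, so at least one of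
  -- them detects `G`.
  by_cases h : (G * (R + Rᴴ)).trace = 0
  · refine ⟨Complex.I • (R - Rᴴ), ?_, fun O hO => ?_, fun h' => hfG ?_⟩
    · rw [IsHermitian, conjTranspose_smul, conjTranspose_sub, conjTranspose_conjTranspose]
      simp only [Complex.star_def, Complex.conj_I, neg_smul, ← smul_neg, neg_sub]
    · rw [Matrix.mul_smul, Matrix.mul_sub, trace_smul, trace_sub, hR𝒮 O hO, hR𝒮' O hO]; simp
    · rw [Matrix.mul_add, trace_add] at h
      rw [Matrix.mul_smul, Matrix.mul_sub, trace_smul, trace_sub, smul_eq_mul,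
        mul_eq_zero_iff_left Complex.I_ne_zero] at h'
      rw [hR]
      linear_combination (h + h') / 2
  · refine ⟨R + Rᴴ, ?_, fun O hO => ?_, h⟩
    · rw [IsHermitian, conjTranspose_add, conjTranspose_conjTranspose, add_comm]
    · rw [Matrix.mul_add, trace_add, hR𝒮 O hO, hR𝒮' O hO, add_zero]

/-- Two matrices with the same unit Hilbert–Schmidt norm whose reduced states agree on `𝒮`, but not
on `G`. -/
lemma exists_purifications {n : Type} [Fintype n] [DecidableEq n]
    {𝒮 : Submodule ℂ (Op n)} (h1 : 1 ∈ 𝒮) (h𝒮 : ∀ O ∈ 𝒮, Oᴴ ∈ 𝒮) {G : Op n}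
    (hG𝒮 : G ∉ 𝒮) :
    ∃ A : Fin 2 → Op n, (∀ a, (A a * (A a)ᴴ).trace = 1) ∧
      (∀ O ∈ 𝒮, (O * (A 0 * (A 0)ᴴ)).trace = (O * (A 1 * (A 1)ᴴ)).trace) ∧
      (G * (A 0 * (A 0)ᴴ)).trace ≠ (G * (A 1 * (A 1)ᴴ)).trace := by
  obtain ⟨T, hT, hT𝒮, hTG⟩ := exists_isHermitian_trace_ne_zero h𝒮 hG𝒮
  have htr : T.trace = 0 := by simpa using hT𝒮 1 h1
  have hTT : 0 < (T * T).trace := by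
    have h0 : 0 ≤ (Tᴴ * T).trace := (posSemidef_conjTranspose_mul_self T).trace_nonneg
    rw [hT.eq] at h0
    refine lt_of_le_of_ne h0 fun h => hTG ?_
    have h2 : (Tᴴ * T).trace = 0 := by rw [hT.eq, ← h]
    rw [trace_conjTranspose_mul_self_eq_zero_iff.1 h2]; simp
  obtain ⟨x, hx0, hx⟩ : ∃ x : ℝ, 0 < x ∧ (1 + T * T).trace = x := by
    refine ⟨Fintype.card n + (T * T).trace.re, ?_, ?_⟩
    · have := (Complex.pos_iff.1 hTT).1
      positivity
    · rw [trace_add, trace_one]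
      apply Complex.ext
      · simp
      · simp [← (Complex.pos_iff.1 hTT).2]
  set N : ℂ := (((Real.sqrt x)⁻¹ : ℝ) : ℂ) with hNdef
  have hNs : star N = N := Complex.conj_ofReal _
  have hN : N * N * x = 1 := by
    rw [hNdef, ← Complex.ofReal_mul, ← Complex.ofReal_mul, ← mul_inv, Real.mul_self_sqrt hx0.le,
      inv_mul_cancel₀ hx0.ne', Complex.ofReal_one]
  have hN0 : N ≠ 0 := fun h => by simp [h] at hN
  -- The two states share the part `1 + T²` and differ by the sign of `2 T`, which is invisible to
  -- `𝒮` (in particular to the trace) but not to `G`.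
  have e0 : (N • (1 + T)) * (N • (1 + T))ᴴ = (N * N) • (1 + T * T) + (2 * (N * N)) • T := by
    rw [conjTranspose_smul, conjTranspose_add, conjTranspose_one, hT.eq, hNs,
      smul_mul_smul_comm, two_mul, add_smul, ← smul_add, ← smul_add]
    congr 1; noncomm_ring
  have e1 : (N • (1 - T)) * (N • (1 - T))ᴴ = (N * N) • (1 + T * T) - (2 * (N * N)) • T := by
    rw [conjTranspose_smul, conjTranspose_sub, conjTranspose_one, hT.eq, hNs,
      smul_mul_smul_comm, two_mul, add_smul, ← smul_add, ← smul_sub]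
    congr 1; noncomm_ring
  refine ⟨![N • (1 + T), N • (1 - T)], ?_, ?_, ?_⟩
  · rw [Fin.forall_fin_two]
    simp only [cons_val_zero, cons_val_one, e0, e1, trace_add, trace_sub, trace_smul, htr,
      ← hN, ← hx]
    simp
  · intro O hO
    simp only [cons_val_zero, cons_val_one, e0, e1, Matrix.mul_add, Matrix.mul_sub,
      Matrix.mul_smul, trace_add, trace_sub, trace_smul, hT𝒮 O hO, smul_zero, add_zero, sub_zero]
  · simp only [cons_val_zero, cons_val_one, e0, e1, Matrix.mul_add G _ _, Matrix.mul_sub G _ _,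
      Matrix.mul_smul, trace_add, trace_sub, trace_smul]
    intro h
    have h3 : (4 * (N * N)) * (G * T).trace = 0 := by
      simp only [smul_eq_mul] at h
      linear_combination h
    simp [hN0, hTG] at h3

end Witness

/-! ### The two-dimensional code and its error correction. -/

section Code

open Matrix

variable {p d : ℕ}

/-- The encoding of basis vector `a` as the purification of `A a * (A a)ᴴ`, with orthogonal
auxiliary supports for different `a`. -/
def purifiedEnc (A : Fin d → Op (Fin p)) : Matrix (Fin p × Fin (p * d)) (Fin d) ℂ :=
  of fun x a => if (finProdFinEquiv.symm x.2).2 = a then A a x.1 (finProdFinEquiv.symm x.2).1 else 0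

lemma purifiedEnc_apply (A : Fin d → Op (Fin p)) (i : Fin p) (y : Fin p × Fin d) (a : Fin d) :
    purifiedEnc A (i, finProdFinEquiv y) a = if y.2 = a then A a i y.1 else 0 := by
  rw [purifiedEnc, of_apply, Equiv.symm_apply_apply]

/-- Operators trivial on the auxiliary space cannot connect code vectors with orthogonal auxiliary
supports, and on each code vector they see only the state that it purifies. -/
lemma purifiedEnc_compress (A : Fin d → Op (Fin p)) (O : Op (Fin p)) :
    (purifiedEnc A)ᴴ * (O ⊗ₖ (1 : Op (Fin (p * d)))) * purifiedEnc A
      = diagonal fun a => (O * (A a * (A a)ᴴ)).trace := by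
  ext a b
  rw [diagonal_apply]
  have key : ((purifiedEnc A)ᴴ * (O ⊗ₖ (1 : Op (Fin (p * d)))) * purifiedEnc A) a b
      = ∑ i, ∑ y : Fin p × Fin d, (∑ i', (if y.2 = a then star (A a i' y.1) else 0) * O i' i)
        * (if y.2 = b then A b i y.1 else 0) := by
    simp only [Matrix.mul_apply]
    rw [Fintype.sum_prod_type]
    refine Finset.sum_congr rfl fun i _ => ?_
    rw [← finProdFinEquiv.sum_comp]
    refine Finset.sum_congr rfl fun y _ => ?_
    simp [purifiedEnc_apply, Fintype.sum_prod_type, Matrix.one_apply, apply_ite (starRingEnd ℂ)]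
  rw [key]
  simp only [Fintype.sum_prod_type]
  split_ifs with hab
  · subst hab
    simp only [mul_ite, mul_zero, Finset.sum_ite_eq', Finset.mem_univ, if_true, Matrix.trace,
      diag_apply, Matrix.mul_apply, conjTranspose_apply, Finset.mul_sum, Finset.sum_mul, ite_mul,
      zero_mul]
    calc _ = ∑ i, ∑ j, ∑ k, star (A a k j) * O k i * A a i j := rfl
      _ = ∑ i, ∑ k, ∑ j, star (A a k j) * O k i * A a i j :=
        Finset.sum_congr rfl fun i _ => Finset.sum_comm
      _ = ∑ k, ∑ i, ∑ j, star (A a k j) * O k i * A a i j := Finset.sum_comm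
      _ = _ := Finset.sum_congr rfl fun k _ => Finset.sum_congr rfl fun i _ =>
        Finset.sum_congr rfl fun j _ => by ring
  · refine Finset.sum_eq_zero fun i _ => Finset.sum_eq_zero fun j _ => Finset.sum_eq_zero fun s _ => ?_
    by_cases h1 : s = a
    · rw [if_neg (fun h2 => hab (h1.symm.trans h2)), mul_zero]
    · simp [h1]

/-- If the compressions to the code of the errors and their products are scalar, some
recovery channel corrects the errors. -/
theorem exists_corrects {dP dA d : ℕ} [NeZero d] {enc : Matrix (Fin dP × Fin dA) (Fin d) ℂ}
    (henc : encᴴ * enc = 1) {ι : Type*} {F : ι → Op (Fin dP × Fin dA)}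
    (hF : ∀ l, ∃ c : ℂ, encᴴ * F l * enc = c • (1 : Op (Fin d)))
    (hFF : ∀ l l', ∃ c : ℂ, encᴴ * ((F l)ᴴ * F l') * enc = c • (1 : Op (Fin d))) :
    ∃ (m : ℕ) (K : Fin m → Op (Fin dP × Fin dA)) (h1 : ∑ l, (K l)ᴴ * K l = 1)
      (h2 : ∀ l, enc * encᴴ * K l = K l), ∀ l, (QECProtocol.mk d enc henc m K h1 h2).Corrects (F l) := by
  -- The recovery acts only after the state is found outside the code, so the relevant errors are
  -- `(1 - P) F enc`. Their Gram scalar is that of the `F l` minus the contribution `star a * b`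
  -- through the code.
  have hW : ∀ l l', ∃ c : ℂ, ((1 - enc * encᴴ) * F l * enc)ᴴ * ((1 - enc * encᴴ) * F l' * enc)
      = c • (1 : Op (Fin d)) := by
    intro l l'
    obtain ⟨a, ha⟩ := hF l
    obtain ⟨b, hb⟩ := hF l'
    obtain ⟨c, hc⟩ := hFF l l'
    have ha' : encᴴ * (F l)ᴴ * enc = star a • (1 : Op (Fin d)) := by
      have := congrArg conjTranspose ha
      simpa [conjTranspose_mul, Matrix.mul_assoc] using this
    have hP : enc * encᴴ * (enc * encᴴ) = enc * encᴴ := by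
      rw [Matrix.mul_assoc, ← Matrix.mul_assoc encᴴ, henc, Matrix.one_mul]
    have hQ : (1 - enc * encᴴ)ᴴ * (1 - enc * encᴴ) = 1 - enc * encᴴ := by
      rw [conjTranspose_sub, conjTranspose_one, conjTranspose_mul, conjTranspose_conjTranspose,
        mul_sub, sub_mul, sub_mul, hP]
      simp
    refine ⟨c - star a * b, ?_⟩
    calc _ = encᴴ * (F l)ᴴ * ((1 - enc * encᴴ)ᴴ * (1 - enc * encᴴ)) * F l' * enc := by
          rw [conjTranspose_mul, conjTranspose_mul]; simp only [Matrix.mul_assoc]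
      _ = encᴴ * ((F l)ᴴ * F l') * enc - (encᴴ * (F l)ᴴ * enc) * (encᴴ * F l' * enc) := by
          rw [hQ]
          simp only [Matrix.mul_sub, Matrix.sub_mul, Matrix.mul_one, Matrix.mul_assoc]
      _ = _ := by
          rw [hc, ha', hb, Matrix.smul_mul, Matrix.mul_smul, Matrix.one_mul, smul_smul, sub_smul]
  obtain ⟨m, K, h1, h2, h3⟩ := exists_recovery hW henc
  refine ⟨m, K, h1, h2, fun l => ⟨?_, fun k => ?_⟩⟩
  · obtain ⟨c, hc⟩ := hF l
    refine ⟨c, ?_⟩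
    simp only [QECProtocol.proj]
    calc _ = enc * (encᴴ * F l * enc) * encᴴ := by simp only [Matrix.mul_assoc]
      _ = _ := by rw [hc]; simp
  · obtain ⟨κ, hκ⟩ := h3 k l
    refine ⟨κ, ?_⟩
    simp only [QECProtocol.proj]
    calc _ = K k * ((1 - enc * encᴴ) * F l * enc) * encᴴ := by simp only [Matrix.mul_assoc]
      _ = _ := by rw [hκ]; simp

end Code

/-! ### Fisher information of a rotating qubit coherence. -/

section FisherInformation

open Matrix

lemma trace_conjTranspose_mul_self_re {m n : Type} [Fintype m] [Fintype n] (D : Matrix m n ℂ) :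
    (Dᴴ * D).trace.re = ∑ j, ∑ i, ‖D i j‖ ^ 2 := by
  simp only [Matrix.trace, diag_apply, Matrix.mul_apply, conjTranspose_apply, Complex.re_sum]
  refine Finset.sum_congr rfl fun j _ => Finset.sum_congr rfl fun i _ => ?_
  rw [Complex.star_def, ← Complex.normSq_eq_conj_mul_self, Complex.ofReal_re,
    Complex.normSq_eq_norm_sq]

/-- If the derivative `D` of a family of states satisfies `ρ D + D ρ = D`, then the quantum Fisher
information is twice the squared Hilbert–Schmidt norm of `D`. -/
lemma qfi_eq_of_anticommute {n : Type} [Fintype n] [DecidableEq n] {ρ : ℝ → Op n} {ω : ℝ}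
    (hρ : (ρ ω).IsHermitian)
    (hD : ρ ω * matrixDeriv ρ ω + matrixDeriv ρ ω * ρ ω = matrixDeriv ρ ω) :
    qfi ρ ω = 2 * ((matrixDeriv ρ ω)ᴴ * matrixDeriv ρ ω).trace.re := by
  set D := matrixDeriv ρ ω
  set γ := hρ.eigenvalues
  set v : n → n → ℂ := fun i a => hρ.eigenvectorBasis i a with hv
  set U : Op n := of fun a i => v i a with hU
  have hUU : Uᴴ * U = 1 := by
    ext i j
    rw [Matrix.one_apply, ← orthonormal_iff_ite.1 hρ.eigenvectorBasis.orthonormal i j,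
      EuclideanSpace.inner_eq_star_dotProduct, dotProduct_comm]
    rfl
  have hUU' : U * Uᴴ = 1 := mul_eq_one_comm.1 hUU
  have hent : ∀ (A : Op n) i j, (Uᴴ * A * U) i j = star (v i) ⬝ᵥ A *ᵥ v j := by
    intro A i j
    rw [Matrix.mul_assoc]
    rfl
  have hρU : ρ ω * U = U * diagonal (fun i => (γ i : ℂ)) := by
    ext a j
    rw [mul_diagonal]
    have h := congrFun (hρ.mulVec_eigenvectorBasis j) a
    calc (ρ ω * U) a j = (ρ ω *ᵥ v j) a := rfl
      _ = (γ j : ℂ) * v j a := by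
        refine h.trans ?_
        simp [γ, v]
      _ = _ := mul_comm _ _
  have hUρ : Uᴴ * ρ ω = diagonal (fun i => (γ i : ℂ)) * Uᴴ := by
    have h := congrArg conjTranspose hρU
    rw [conjTranspose_mul, conjTranspose_mul, hρ.eq, diagonal_conjTranspose] at h
    rw [h]
    congr 2
    funext i
    simp
  -- In the eigenbasis the hypothesis says that an entry of the derivative vanishes unless `γ i + γ
  -- j = 1`, so every denominator that matters equals 1.
  have hE : ∀ i j, ((γ i : ℂ) + γ j) * (Uᴴ * D * U) i j = (Uᴴ * D * U) i j := by
    intro i j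
    have h : Uᴴ * (ρ ω * D + D * ρ ω) * U = diagonal (fun i => (γ i : ℂ)) * (Uᴴ * D * U)
        + (Uᴴ * D * U) * diagonal (fun i => (γ i : ℂ)) := by
      rw [Matrix.mul_add, Matrix.add_mul, ← Matrix.mul_assoc, hUρ, ← Matrix.mul_assoc Uᴴ D,
        Matrix.mul_assoc (Uᴴ * D), hρU]
      simp only [Matrix.mul_assoc]
    rw [hD] at h
    conv_rhs => rw [h]
    rw [Matrix.add_apply, diagonal_mul, mul_diagonal]
    ring
  have hterm : ∀ i j, (if 0 < γ i + γ j then ‖star (v i) ⬝ᵥ D *ᵥ v j‖ ^ 2 / (γ i + γ j) else 0)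
      = ‖(Uᴴ * D * U) i j‖ ^ 2 := by
    intro i j
    rw [← hent]
    by_cases h0 : (Uᴴ * D * U) i j = 0
    · simp [h0]
    · have h1 : (γ i : ℂ) + γ j = 1 := mul_right_cancel₀ h0 ((hE i j).trans (one_mul _).symm)
      have h2 : γ i + γ j = 1 := by exact_mod_cast h1
      rw [h2, if_pos one_pos, div_one]
  have htr : (Dᴴ * D).trace = ((Uᴴ * D * U)ᴴ * (Uᴴ * D * U)).trace := by
    calc (Dᴴ * D).trace = (Dᴴ * (U * Uᴴ) * D * (U * Uᴴ)).trace := by rw [hUU']; simp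
      _ = (Uᴴ * (Dᴴ * (U * Uᴴ) * D * U)).trace := by
        rw [trace_mul_comm Uᴴ]; simp only [Matrix.mul_assoc]
      _ = _ := by
        simp only [conjTranspose_mul, conjTranspose_conjTranspose, Matrix.mul_assoc]
  rw [qfi, dif_pos hρ, htr, trace_conjTranspose_mul_self_re, Finset.sum_comm]
  congr 1
  exact Finset.sum_congr rfl fun i _ => Finset.sum_congr rfl fun j _ => hterm j i

lemma hasDerivAt_mul_mul_apply {m n : Type} [Fintype n] {M : ℝ → Op n} {M' : Op n} {ω : ℝ}
    (h : ∀ i j, HasDerivAt (fun w => M w i j) (M' i j) ω) (A : Matrix m n ℂ) (B : Matrix n m ℂ)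
    (a b : m) : HasDerivAt (fun w => (A * M w * B) a b) ((A * M' * B) a b) ω := by
  simp only [Matrix.mul_apply]
  exact HasDerivAt.fun_sum fun j _ =>
    (HasDerivAt.fun_sum fun i _ => (h i j).const_mul _).mul_const _

/-- The state of a qubit with maximally mixed populations and coherence `z`. -/
noncomputable def coherenceState (z : ℂ) : Op (Fin 2) := !![1 / 2, z / 2; star z / 2, 1 / 2]

/-- Rotating the coherence of an encoded qubit at speed `s` gives the quantum Fisher
information `s ^ 2 |z| ^ 2`. -/
lemma qfi_coherenceState {S : Type} [Fintype S] [DecidableEq S] {enc : Matrix S (Fin 2) ℂ}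
    (henc : encᴴ * enc = 1) {z : ℝ → ℂ} {s ω : ℝ}
    (hz : HasDerivAt z (-(Complex.I * s) * z ω) ω) :
    (∀ a b, DifferentiableAt ℝ (fun w => (enc * coherenceState (z w) * encᴴ) a b) ω) ∧
      qfi (fun w => enc * coherenceState (z w) * encᴴ) ω = s ^ 2 * ‖z ω‖ ^ 2 := by
  set z' := -(Complex.I * s) * z ω with hz'
  set M' : Op (Fin 2) := !![0, z' / 2; star z' / 2, 0] with hM'
  have hent : ∀ i j, HasDerivAt (fun w => coherenceState (z w) i j) (M' i j) ω := by
    rw [Fin.forall_fin_two]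
    refine ⟨Fin.forall_fin_two.2 ⟨?_, ?_⟩, Fin.forall_fin_two.2 ⟨?_, ?_⟩⟩
    · exact hasDerivAt_const _ _
    · exact hz.div_const 2
    · exact hz.star.div_const 2
    · exact hasDerivAt_const _ _
  have hder := hasDerivAt_mul_mul_apply hent enc encᴴ
  have hD : matrixDeriv (fun w => enc * coherenceState (z w) * encᴴ) ω = enc * M' * encᴴ := by
    ext a b
    exact (hder a b).deriv
  refine ⟨fun a b => (hder a b).differentiableAt, ?_⟩
  have hmul : ∀ A B : Op (Fin 2), enc * A * encᴴ * (enc * B * encᴴ) = enc * (A * B) * encᴴ := by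
    intro A B
    calc _ = enc * A * (encᴴ * enc) * B * encᴴ := by simp only [Matrix.mul_assoc]
      _ = _ := by rw [henc, Matrix.mul_one]; simp only [Matrix.mul_assoc]
  have hcoh : (coherenceState (z ω))ᴴ = coherenceState (z ω) := by
    ext i j
    fin_cases i <;> fin_cases j <;> simp [coherenceState]
  -- The populations 1/2 contribute exactly `M'`; the coherence part anticommutes with `M'`, because
  -- the derivative is orthogonal to `z` in the complex plane.
  have hanti : coherenceState (z ω) * M' + M' * coherenceState (z ω) = M' := by
    ext i j
    fin_cases i <;> fin_cases j <;>
      simp [coherenceState, hM', hz'] <;> ring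
  have hM'h : M'ᴴ = M' := by
    ext i j
    fin_cases i <;> fin_cases j <;> simp [hM']
  have htr : (M' * M').trace.re = s ^ 2 * ‖z ω‖ ^ 2 / 2 := by
    have h : (M' * M').trace = ((‖z'‖ ^ 2 / 2 : ℝ) : ℂ) := by
      rw [Matrix.trace_fin_two, Complex.ofReal_div, ← Complex.normSq_eq_norm_sq,
        Complex.normSq_eq_conj_mul_self]
      simp [hM', Matrix.mul_apply, Fin.sum_univ_two]
      ring
    rw [h, Complex.ofReal_re, hz', norm_mul, mul_pow]
    simp
  rw [qfi_eq_of_anticommute, hD]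
  · rw [conjTranspose_mul, conjTranspose_mul, conjTranspose_conjTranspose, hM'h,
      ← Matrix.mul_assoc enc, hmul, trace_mul_comm, ← Matrix.mul_assoc, henc, Matrix.one_mul, htr]
    ring
  · rw [IsHermitian, conjTranspose_mul, conjTranspose_mul, conjTranspose_conjTranspose, hcoh,
      ← Matrix.mul_assoc]
  · rw [hD, hmul, hmul, ← Matrix.add_mul, ← Matrix.mul_add, hanti]

end FisherInformation

/-! ### Almost periodicity of trigonometric sums. -/

section AlmostPeriodic

open Filter Topology

/-- The almost periods of finitely many characters of the line are relatively dense. -/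
lemma exists_almost_period {ι : Type*} [Fintype ι] (δ : ι → ℝ) {ε : ℝ} (hε : 0 < ε) :
    ∃ l > 0, ∀ a : ℝ, ∃ τ ∈ Set.Icc a (a + l),
      ∀ i, ‖Complex.exp (-(Complex.I * (τ * δ i : ℝ))) - 1‖ < ε := by
  set x : ℝ → ι → ℂ := fun t i => Complex.exp (-(Complex.I * (t * δ i : ℝ))) with hx
  have hnorm : ∀ t i, ‖x t i‖ = 1 := by
    intro t i
    rw [hx, Complex.norm_exp]; simp
  have hadd : ∀ s t i, x (s - t) i * x t i = x s i := by
    intro s t i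
    simp only [hx]
    rw [← Complex.exp_add]
    congr 1
    push_cast; ring
  have hbdd : TotallyBounded (Set.range x) := by
    refine (isCompact_closedBall (0 : ι → ℂ) 1).totallyBounded.subset ?_
    rintro _ ⟨t, rfl⟩
    rw [mem_closedBall_zero_iff]
    exact (pi_norm_le_iff_of_nonneg zero_le_one).2 fun i => (hnorm t i).le
  obtain ⟨F, hF, hFfin, hcov⟩ := Metric.finite_approx_of_totallyBounded hbdd ε hε
  choose! u hu using fun y (hy : y ∈ F) => hF hy
  obtain ⟨R, hR⟩ := (hFfin.image fun y => |u y|).bddAbove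
  -- By total boundedness of the orbit on the torus, every time `s` has its characters within `ε` of
  -- those at one of finitely many times `u y`, and then `s - u y` is an almost period. Taking `s =
  -- a + (|R| + 1)` with `|u y| ≤ |R| + 1` places it in the window.
  refine ⟨2 * (|R| + 1), by positivity, fun a => ?_⟩
  obtain ⟨y, hy, hay⟩ := Set.mem_iUnion₂.1 (hcov ⟨a + (|R| + 1), rfl⟩)
  have huy : |u y| ≤ |R| + 1 := by
    have := hR ⟨y, hy, rfl⟩
    have := le_abs_self R
    linarith
  obtain ⟨h1, h2⟩ := abs_le.1 huy
  refine ⟨a + (|R| + 1) - u y, ⟨by linarith, by linarith⟩, fun i => ?_⟩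
  rw [Metric.mem_ball, dist_eq_norm, ← hu y hy] at hay
  have h3 := (norm_le_pi_norm _ i).trans_lt hay
  rw [Pi.sub_apply, ← hadd (a + (|R| + 1)) (u y) i, ← sub_one_mul, norm_mul, hnorm, mul_one] at h3
  exact h3

variable {ι : Type*} [Fintype ι]

/-- The characteristic function of the finite distribution giving weight `p i` to `δ i`. -/
noncomputable def charSum (p δ : ι → ℝ) (t : ℝ) : ℂ :=
  ∑ i, (p i : ℂ) * Complex.exp (-(Complex.I * (t * δ i : ℝ)))

lemma charSum_zero {p : ι → ℝ} (hp1 : ∑ i, p i = 1) (δ : ι → ℝ) : charSum p δ 0 = 1 := by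
  simp [charSum, ← Complex.ofReal_sum, hp1]

lemma norm_charSum_le_one {p : ι → ℝ} (hp : ∀ i, 0 ≤ p i) (hp1 : ∑ i, p i = 1) (δ : ι → ℝ)
    (t : ℝ) : ‖charSum p δ t‖ ≤ 1 := by
  rw [← hp1]
  refine (norm_sum_le _ _).trans (Finset.sum_le_sum fun i _ => ?_)
  rw [norm_mul, Complex.norm_exp, Complex.norm_real, Real.norm_of_nonneg (hp i)]
  simp

lemma isAlmostPeriodic_charSum {p : ι → ℝ} (hp : ∀ i, 0 ≤ p i) (hp1 : ∑ i, p i = 1) (δ : ι → ℝ)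
    (g : ℝ) : IsAlmostPeriodic fun t => g ^ 2 * ‖charSum p δ t‖ ^ 2 := by
  constructor
  · unfold charSum; fun_prop
  intro ε hε
  -- Passing from norms at most 1 to their squares costs a factor 2, and `g ^ 2` multiplies the
  -- result; the `+ 1` covers `g = 0`.
  obtain ⟨l, hl, h⟩ := exists_almost_period δ (ε := ε / (2 * g ^ 2 + 1)) (by positivity)
  refine ⟨l, hl, fun a => ?_⟩
  obtain ⟨τ, hτ, hτδ⟩ := h a
  refine ⟨τ, hτ, fun t => ?_⟩
  have h1 : ‖charSum p δ (t + τ) - charSum p δ t‖ ≤ ε / (2 * g ^ 2 + 1) := by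
    rw [charSum, charSum, ← Finset.sum_sub_distrib]
    calc _ ≤ ∑ i, p i * (ε / (2 * g ^ 2 + 1)) := by
          refine (norm_sum_le _ _).trans (Finset.sum_le_sum fun i _ => ?_)
          have e : (p i : ℂ) * Complex.exp (-(Complex.I * ((t + τ) * δ i : ℝ)))
              - (p i : ℂ) * Complex.exp (-(Complex.I * (t * δ i : ℝ)))
              = (p i : ℂ) * Complex.exp (-(Complex.I * (t * δ i : ℝ)))
                * (Complex.exp (-(Complex.I * (τ * δ i : ℝ))) - 1) := by
            rw [mul_sub, mul_assoc, ← Complex.exp_add, mul_one]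
            congr 3
            push_cast; ring
          rw [e, norm_mul, norm_mul, Complex.norm_exp, Complex.norm_real,
            Real.norm_of_nonneg (hp i)]
          simpa using mul_le_mul_of_nonneg_left (hτδ i).le (hp i)
      _ = _ := by rw [← Finset.sum_mul, hp1, one_mul]
  have h2 := (abs_norm_sub_norm_le _ _).trans h1
  have h3 := norm_charSum_le_one hp hp1 δ (t + τ)
  have h4 := norm_charSum_le_one hp hp1 δ t
  have h5 : |‖charSum p δ (t + τ)‖ + ‖charSum p δ t‖| ≤ 2 := by
    rw [abs_of_nonneg (by positivity)]; linarith
  calc _ = g ^ 2 * (|‖charSum p δ (t + τ)‖ - ‖charSum p δ t‖|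
        * |‖charSum p δ (t + τ)‖ + ‖charSum p δ t‖|) := by
        rw [← abs_mul, ← mul_sub, abs_mul, abs_of_nonneg (sq_nonneg g)]
        congr 2; ring
    _ ≤ g ^ 2 * (ε / (2 * g ^ 2 + 1) * 2) := by gcongr
    _ ≤ ε := by
        rw [← mul_assoc, ← mul_div_assoc, div_mul_eq_mul_div, div_le_iff₀ (by positivity)]
        nlinarith

/-- There are arbitrarily late almost periods, and at them `f` is at least `f 0 / 2`. -/
lemma IsAlmostPeriodic.limsup_pos {f : ℝ → ℝ} (hf : IsAlmostPeriodic f) (h0 : 0 < f 0) :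
    0 < limsup (fun t => ((f t : ℝ) : EReal)) atTop := by
  obtain ⟨l, -, h⟩ := hf.2 (f 0 / 2) (half_pos h0)
  have hfreq : ∃ᶠ t in atTop, ((f 0 / 2 : ℝ) : EReal) ≤ ((f t : ℝ) : EReal) := by
    rw [frequently_atTop]
    intro a
    obtain ⟨τ, hτ, hτf⟩ := h a
    have := hτf 0
    rw [zero_add, abs_le] at this
    exact ⟨τ, hτ.1, EReal.coe_le_coe_iff.2 (by linarith [this.1])⟩
  exact lt_of_lt_of_le (EReal.coe_pos.2 (half_pos h0)) (le_limsup_of_frequently_le hfreq)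

end AlmostPeriodic

/-! ### The effective evolution of encoded states. -/

section EncodedEvolution

open Filter Topology Matrix

/-- An intertwining relation passes to powers and so to the exponential series. With `B` an encoded
branch, it reduces the exponential of the joint Hamiltonian to one on the small code space. -/
lemma exp_mul_of_mul_eq_mul {m k : Type} [Fintype m] [DecidableEq m] [Fintype k] [DecidableEq k]
    {A : Op m} {B : Matrix m k ℂ} {D : Op k} (h : A * B = B * D) :
    NormedSpace.exp A * B = B * NormedSpace.exp D := by
  let _ : NormedRing (Op m) := Matrix.linftyOpNormedRing
  let _ : NormedAlgebra ℂ (Op m) := Matrix.linftyOpNormedAlgebra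
  let _ : NormedRing (Op k) := Matrix.linftyOpNormedRing
  let _ : NormedAlgebra ℂ (Op k) := Matrix.linftyOpNormedAlgebra
  let f : Op m →ₗ[ℂ] Matrix m k ℂ :=
    { toFun := fun X => X * B
      map_add' := fun _ _ => Matrix.add_mul _ _ _
      map_smul' := fun _ _ => Matrix.smul_mul _ _ _ }
  let g : Op k →ₗ[ℂ] Matrix m k ℂ :=
    { toFun := fun X => B * X
      map_add' := fun _ _ => Matrix.mul_add _ _ _
      map_smul' := fun _ _ => Matrix.mul_smul _ _ _ }
  have hf := (NormedSpace.exp_series_hasSum_exp' (𝕂 := ℂ) A).map f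
    f.continuous_of_finiteDimensional
  have hg := (NormedSpace.exp_series_hasSum_exp' (𝕂 := ℂ) D).map g
    g.continuous_of_finiteDimensional
  have hpow : ∀ n : ℕ, A ^ n * B = B * D ^ n := by
    intro n
    induction n with
    | zero => rw [pow_zero, pow_zero, Matrix.one_mul, Matrix.mul_one]
    | succ n ih => rw [pow_succ', pow_succ, Matrix.mul_assoc, ih, ← Matrix.mul_assoc, h,
        Matrix.mul_assoc, ← pow_succ', pow_succ]
  have hfg : (f ∘ fun n : ℕ => ((n.factorial : ℂ)⁻¹) • A ^ n)
      = g ∘ fun n : ℕ => ((n.factorial : ℂ)⁻¹) • D ^ n := by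
    funext n
    change (((n.factorial : ℂ)⁻¹) • A ^ n) * B = B * (((n.factorial : ℂ)⁻¹) • D ^ n)
    rw [Matrix.smul_mul, Matrix.mul_smul, hpow]
  rw [hfg] at hf
  exact hf.unique hg

variable {dE dP dA r : ℕ} {φ : OrthonormalBasis (Fin dE) ℂ (EuclideanSpace ℂ (Fin dE))}

lemma extendAux_isHermitian {X : Op (Fin dE × Fin dP)} (hX : X.IsHermitian) :
    (extendAux dA X).IsHermitian := by
  rw [extendAux, reindex_apply]
  refine IsHermitian.submatrix ?_ _
  rw [IsHermitian, conjTranspose_kronecker, conjTranspose_one, hX.eq]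

lemma HMM.effectiveHamiltonian_isHermitian (M : HMM dE dP r) (C : QECProtocol dP dA) (ω : ℝ) :
    (M.effectiveHamiltonian C ω).IsHermitian := by
  have h1 : (M.signalP dA)ᴴ = M.signalP dA := by
    rw [HMM.signalP, ← onRight_conjTranspose, conjTranspose_kronecker, conjTranspose_one,
      M.G_herm.eq]
  rw [IsHermitian, HMM.effectiveHamiltonian, conjTranspose_mul, conjTranspose_mul,
    conjTranspose_add, conjTranspose_smul, h1, (extendAux_isHermitian M.HEP_herm).eq,
    C.onRight_proj_conjTranspose, Complex.star_def, Complex.conj_ofReal, Matrix.mul_assoc]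

lemma effectiveHamiltonian_mul_kronecker {M : HMM dE dP r} (hM : M.IsDiagonal φ)
    (C : QECProtocol dP dA) (ω : ℝ) (i : Fin dE) :
    M.effectiveHamiltonian C ω * (ketbra (fun e => φ i e) ⊗ₖ C.enc)
      = (ketbra (fun e => φ i e) ⊗ₖ C.enc) * onRight dE (C.encᴴ
        * (((ω : ℂ) • M.G + block φ M.HEP i i) ⊗ₖ (1 : Op (Fin dA))) * C.enc) := by
  set k := ketbra (fun e => φ i e)
  have h1 : ∀ Z : Matrix (Fin dP × Fin dA) (Fin C.d) ℂ,
      onRight dE C.proj * (k ⊗ₖ Z) = k ⊗ₖ (C.proj * Z) := fun Z => by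
    rw [onRight, ← mul_kronecker_mul, Matrix.one_mul]
  have h2 : C.proj * C.enc = C.enc := by
    rw [QECProtocol.proj, Matrix.mul_assoc, C.enc_isometry, Matrix.mul_one]
  have h3 : M.signalP dA * (k ⊗ₖ C.enc) = k ⊗ₖ ((M.G ⊗ₖ (1 : Op (Fin dA))) * C.enc) := by
    rw [HMM.signalP, onRight, ← mul_kronecker_mul, Matrix.one_mul]
  have hkk : k * k = k := by
    rw [ketbra_mul_ketbra, star_dotProduct_orthonormalBasis, if_pos rfl, one_smul]; rfl
  have h4 : extendAux dA M.HEP * (k ⊗ₖ C.enc)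
      = k ⊗ₖ ((block φ M.HEP i i ⊗ₖ (1 : Op (Fin dA))) * C.enc) := by
    have e : k ⊗ₖ C.enc = envProj φ (Fin dP × Fin dA) i * (k ⊗ₖ C.enc) := by
      rw [envProj, ← mul_kronecker_mul, hkk, Matrix.one_mul]
    rw [e, ← Matrix.mul_assoc, hM.2.1.extendAux_mul_envProj, Matrix.mul_assoc, ← e, onRight,
      ← mul_kronecker_mul, Matrix.one_mul]
  have h5 : k ⊗ₖ (C.proj * ((((ω : ℂ) • M.G + block φ M.HEP i i) ⊗ₖ (1 : Op (Fin dA))) * C.enc))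
      = (k ⊗ₖ C.enc) * onRight dE (C.encᴴ
        * (((ω : ℂ) • M.G + block φ M.HEP i i) ⊗ₖ (1 : Op (Fin dA))) * C.enc) := by
    rw [onRight, ← mul_kronecker_mul, Matrix.mul_one, QECProtocol.proj]
    simp only [Matrix.mul_assoc]
  rw [← h5, HMM.effectiveHamiltonian, Matrix.mul_assoc, h1, h2, Matrix.mul_assoc, Matrix.add_mul,
    Matrix.smul_mul, h3, h4, add_kronecker, smul_kronecker, Matrix.add_mul, Matrix.smul_mul,
    ← kronecker_smul, ← kronecker_add, h1]

lemma exp_smul_onRight_diagonal {d : ℕ} (c : ℂ) (ε : Fin d → ℝ) :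
    NormedSpace.exp (c • onRight dE (diagonal fun a => (ε a : ℂ)))
      = onRight dE (diagonal fun a => Complex.exp (c * ε a)) := by
  have h : ∀ v : Fin d → ℂ, onRight dE (diagonal v) = diagonal fun x : Fin dE × Fin d => v x.2 := by
    intro v
    rw [onRight, ← diagonal_one, diagonal_kronecker_diagonal]
    simp
  rw [h, h, ← diagonal_smul, exp_diagonal]
  congr 1
  funext x
  rw [Pi.coe_exp, Complex.exp_eq_exp_ℂ]
  rfl

lemma ketbra_conjTranspose {n : Type} (v : n → ℂ) : (ketbra v)ᴴ = ketbra v := by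
  rw [ketbra, conjTranspose_vecMulVec, star_star]

/-- The effective evolution of an encoded state, in the environment state `φ i` for which the
effective Hamiltonian is diagonal on the code space. -/
lemma exp_mul_kronecker_mul_exp {M : HMM dE dP r} (hM : M.IsDiagonal φ) (C : QECProtocol dP dA)
    {ω : ℝ} {i : Fin dE} {ε : Fin C.d → ℝ}
    (hε : C.encᴴ * (((ω : ℂ) • M.G + block φ M.HEP i i) ⊗ₖ (1 : Op (Fin dA))) * C.enc
      = diagonal fun a => (ε a : ℂ)) (t : ℝ) (X : Op (Fin C.d)) :
    NormedSpace.exp ((-(Complex.I * t)) • M.effectiveHamiltonian C ω)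
        * (ketbra (fun e => φ i e) ⊗ₖ (C.enc * X * C.encᴴ))
        * NormedSpace.exp ((Complex.I * t) • M.effectiveHamiltonian C ω)
      = ketbra (fun e => φ i e) ⊗ₖ (C.enc
        * (diagonal (fun a => Complex.exp (-(Complex.I * t) * ε a)) * X
          * (diagonal (fun a => Complex.exp (-(Complex.I * t) * ε a)))ᴴ) * C.encᴴ) := by
  set k := ketbra (fun e => φ i e)
  set V := diagonal (fun a => Complex.exp (-(Complex.I * t) * ε a))
  set H := M.effectiveHamiltonian C ω with hH
  have hkk : k * k = k := by
    rw [ketbra_mul_ketbra, star_dotProduct_orthonormalBasis, if_pos rfl, one_smul]; rfl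
  have hk : kᴴ = k := ketbra_conjTranspose _
  have h1 : NormedSpace.exp ((-(Complex.I * t)) • H) * (k ⊗ₖ C.enc) = k ⊗ₖ (C.enc * V) := by
    have e : ((-(Complex.I * t)) • H) * (k ⊗ₖ C.enc) = (k ⊗ₖ C.enc)
        * ((-(Complex.I * t)) • onRight dE (diagonal fun a => (ε a : ℂ))) := by
      rw [Matrix.smul_mul, hH, effectiveHamiltonian_mul_kronecker hM, hε, Matrix.mul_smul]
    rw [exp_mul_of_mul_eq_mul e, exp_smul_onRight_diagonal, onRight, ← mul_kronecker_mul,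
      Matrix.mul_one]
  have h2 : NormedSpace.exp ((Complex.I * t) • H)
      = (NormedSpace.exp ((-(Complex.I * t)) • H))ᴴ := by
    rw [← exp_conjTranspose, conjTranspose_smul, (M.effectiveHamiltonian_isHermitian C ω).eq]
    congr 2
    simp
  have h3 : k ⊗ₖ (C.enc * X * C.encᴴ) = (k ⊗ₖ C.enc) * (k ⊗ₖ X) * (k ⊗ₖ C.enc)ᴴ := by
    rw [conjTranspose_kronecker, hk, ← mul_kronecker_mul, ← mul_kronecker_mul, hkk, hkk]
  rw [h2, h3, ← Matrix.mul_assoc, ← Matrix.mul_assoc, h1, Matrix.mul_assoc, ← conjTranspose_mul,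
    h1, conjTranspose_kronecker, hk, ← mul_kronecker_mul, ← mul_kronecker_mul, hkk, hkk,
    conjTranspose_mul]
  simp only [Matrix.mul_assoc]

lemma traceE_add {S : Type} (X Y : Op (Fin dE × S)) : traceE (X + Y) = traceE X + traceE Y := by
  ext s s'
  simp [traceE, Finset.sum_add_distrib]

lemma traceE_sum {ι : Type*} {S : Type} (s : Finset ι) (X : ι → Op (Fin dE × S)) :
    traceE (∑ i ∈ s, X i) = ∑ i ∈ s, traceE (X i) :=
  map_sum (⟨⟨traceE, by ext; simp [traceE]⟩, traceE_add⟩ : Op (Fin dE × S) →+ Op S) X s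

lemma traceE_ketbra_kronecker {S : Type} (i : Fin dE) (Y : Op S) :
    traceE (ketbra (fun e => φ i e) ⊗ₖ Y) = Y := by
  ext s s'
  have h := star_dotProduct_orthonormalBasis φ i i
  rw [if_pos rfl] at h
  simp only [traceE, of_apply, kroneckerMap_apply]
  rw [← Finset.sum_mul]
  conv_rhs => rw [← one_mul (Y s s'), ← h]
  congr 1
  exact Finset.sum_congr rfl fun e _ => mul_comm _ _

/-- By completeness of `φ`, the trace over the environment is the sum of its diagonal blocks. -/
lemma traceE_dephase {S : Type} [Fintype S] [DecidableEq S] (X : Op (Fin dE × S)) :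
    traceE (dephase φ S X) = traceE X := by
  simp only [dephase_apply, envProj_mul_mul_envProj, traceE_sum, traceE_ketbra_kronecker]
  have hδ : ∀ e e', ∑ i, φ i e' * star (φ i e) = if e' = e then 1 else 0 := by
    intro e e'
    have h := congrFun (congrFun (sum_ketbra_orthonormalBasis φ) e') e
    rw [Matrix.sum_apply, Matrix.one_apply] at h
    exact h
  ext s s'
  simp only [Matrix.sum_apply, block, of_apply, traceE]
  rw [Finset.sum_comm]
  refine Finset.sum_congr rfl fun e _ => ?_
  rw [Finset.sum_comm]
  calc _ = ∑ e', X (e, s) (e', s') * ∑ i, φ i e' * star (φ i e) := by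
        refine Finset.sum_congr rfl fun e' _ => ?_
        rw [Finset.mul_sum]
        exact Finset.sum_congr rfl fun i _ => by ring
    _ = _ := by
        simp only [hδ, mul_ite, mul_one, mul_zero, Finset.sum_ite_eq', Finset.mem_univ, if_true]

lemma continuous_traceE {S : Type} : Continuous (traceE : Op (Fin dE × S) → Op S) :=
  continuous_matrix fun s s' => by
    change Continuous fun X : Op (Fin dE × S) => ∑ e, X (e, s) (e, s')
    exact continuous_finsetSum _ fun e _ => continuous_id.matrix_elem (e, s) (e, s')

/-- The populations of a state of the environment in the basis `φ`. -/
lemma exists_populations (φ : OrthonormalBasis (Fin dE) ℂ (EuclideanSpace ℂ (Fin dE)))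
    {ρE : Op (Fin dE)} (hρ : IsDensity ρE) :
    ∃ p : Fin dE → ℝ, (∀ i, 0 ≤ p i) ∧ ∑ i, p i = 1 ∧
      ∀ (S : Type) [Fintype S] [DecidableEq S] (Y : Op S), dephase φ S (ρE ⊗ₖ Y)
        = ∑ i, (p i : ℂ) • (ketbra (fun e => φ i e) ⊗ₖ Y) := by
  set v : Fin dE → Fin dE → ℂ := fun i e => φ i e
  have h0 : ∀ i, 0 ≤ star (v i) ⬝ᵥ ρE *ᵥ v i := fun i => hρ.1.dotProduct_mulVec_nonneg (v i)
  have hre : ∀ i, ((star (v i) ⬝ᵥ ρE *ᵥ v i).re : ℂ) = star (v i) ⬝ᵥ ρE *ᵥ v i := fun i =>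
    Complex.ext rfl (Complex.nonneg_iff.1 (h0 i)).2
  refine ⟨fun i => (star (v i) ⬝ᵥ ρE *ᵥ v i).re, fun i => (Complex.nonneg_iff.1 (h0 i)).1, ?_, ?_⟩
  · apply Complex.ofReal_injective
    rw [Complex.ofReal_sum, Complex.ofReal_one, ← hρ.2]
    simp only [hre]
    calc _ = ∑ i, (ρE * ketbra (v i)).trace := by
          refine Finset.sum_congr rfl fun i _ => ?_
          rw [ketbra, mul_vecMulVec, trace_vecMulVec, dotProduct_comm]
      _ = (ρE * ∑ i, ketbra (v i)).trace := by rw [Matrix.mul_sum, trace_sum]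
      _ = _ := by rw [sum_ketbra_orthonormalBasis, Matrix.mul_one]
  · intro S _ _ Y
    rw [dephase_apply]
    refine Finset.sum_congr rfl fun i _ => ?_
    have h : ketbra (v i) * ρE * ketbra (v i)
        = (star (v i) ⬝ᵥ ρE *ᵥ v i) • ketbra (v i) := by
      rw [ketbra, Matrix.mul_assoc, mul_vecMulVec, vecMulVec_mul_vecMulVec, vecMulVec_smul]
    rw [envProj, ← mul_kronecker_mul, ← mul_kronecker_mul, Matrix.one_mul, Matrix.mul_one, h, hre,
      smul_kronecker]

lemma ketbra_mulVec {m n : Type} [Fintype n] (A : Matrix m n ℂ) (v : n → ℂ) :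
    ketbra (A *ᵥ v) = A * ketbra v * Aᴴ := by
  rw [ketbra, ketbra, mul_vecMulVec, vecMulVec_mul, star_mulVec]

/-- The reduced state of probe and auxiliary system under fast error correction, if the effective
Hamiltonian is diagonal on the code space. -/
theorem tendsto_traceE_correctedState {M : HMM dE dP r} (hM : M.IsDiagonal φ)
    {C : QECProtocol dP dA}
    (hC : ∀ k i, C.Corrects (block φ (M.L k) i i ⊗ₖ (1 : Op (Fin dA)))) {ρE : Op (Fin dE)}
    {p : Fin dE → ℝ} (hp : ∀ Y : Op (Fin dP × Fin dA), dephase φ _ (ρE ⊗ₖ Y)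
        = ∑ i, (p i : ℂ) • (ketbra (fun e => φ i e) ⊗ₖ Y)) {ω : ℝ} {ε : Fin dE → Fin C.d → ℝ}
    (hε : ∀ i, C.encᴴ * (((ω : ℂ) • M.G + block φ M.HEP i i) ⊗ₖ (1 : Op (Fin dA))) * C.enc
      = diagonal fun a => (ε i a : ℂ)) (ψ : Fin C.d → ℂ) (t : ℝ) :
    Tendsto (fun n => traceE (M.correctedState C ω t (ρE ⊗ₖ ketbra (C.enc *ᵥ ψ)) n)) atTop
      (𝓝 (C.enc * (∑ i, (p i : ℂ) • (diagonal (fun a => Complex.exp (-(Complex.I * t) * ε i a))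
        * ketbra ψ * (diagonal (fun a => Complex.exp (-(Complex.I * t) * ε i a)))ᴴ)) * C.encᴴ)) := by
  -- Dephasing commutes with the corrected dynamics and is invisible to `traceE`, so the limit
  -- theorem for diagonal states applies to arbitrary `ρE`.
  set ρ := dephase φ _ (ρE ⊗ₖ ketbra (C.enc *ᵥ ψ)) with hρ
  have hd : IsEnvDiagonal φ ρ := by
    rw [isEnvDiagonal_iff_dephase]
    exact LinearMap.congr_fun dephase_mul_dephase _
  have hP : onRight dE C.proj * ρ * onRight dE C.proj = ρ := by
    rw [hρ, hp, Matrix.mul_sum, Matrix.sum_mul]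
    refine Finset.sum_congr rfl fun i _ => ?_
    rw [Matrix.mul_smul, Matrix.smul_mul, onRight, ← mul_kronecker_mul, ← mul_kronecker_mul,
      Matrix.one_mul, Matrix.mul_one, ketbra_mulVec, QECProtocol.proj]
    congr 2
    calc _ = C.enc * (C.encᴴ * C.enc) * ketbra ψ * (C.encᴴ * C.enc) * C.encᴴ := by
          simp only [Matrix.mul_assoc]
      _ = _ := by rw [C.enc_isometry, Matrix.mul_one, Matrix.mul_one]
  have h := (continuous_traceE.tendsto _).comp (tendsto_correctedState hM hC hd hP ω t)
  have e1 : ∀ n, traceE (M.correctedState C ω t (ρE ⊗ₖ ketbra (C.enc *ᵥ ψ)) n)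
      = traceE (M.correctedState C ω t ρ n) := fun n => by
    rw [hρ, ← dephase_correctedState hM, traceE_dephase]
  refine (Tendsto.congr (fun n => (e1 n).symm) h).trans_eq (congrArg 𝓝 ?_)
  rw [hρ, hp, Matrix.mul_sum, Matrix.sum_mul, traceE_sum, Matrix.mul_sum, Matrix.sum_mul]
  refine Finset.sum_congr rfl fun i _ => ?_
  rw [ketbra_mulVec, Matrix.mul_smul, Matrix.smul_mul, exp_mul_kronecker_mul_exp hM C (hε i),
    ← kronecker_smul, traceE_ketbra_kronecker, Matrix.mul_smul, Matrix.smul_mul]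

end EncodedEvolution

/-! ### Assembly of the theorem. -/

section MainTheorem

open Matrix

lemma star_dotProduct_uniformQubit :
    star (fun _ : Fin 2 => (((Real.sqrt 2)⁻¹ : ℝ) : ℂ)) ⬝ᵥ (fun _ => (((Real.sqrt 2)⁻¹ : ℝ) : ℂ))
      = 1 := by
  have h : (Real.sqrt 2)⁻¹ * (Real.sqrt 2)⁻¹ = 1 / 2 := by
    rw [← mul_inv, Real.mul_self_sqrt zero_le_two, one_div]
  simp only [dotProduct, Pi.star_apply, Complex.star_def, Complex.conj_ofReal,
    ← Complex.ofReal_mul, h]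
  simp

/-- A mixture of phase rotations of the uniform superposition of a qubit. -/
lemma sum_dephased_eq_coherenceState {ι : Type} [Fintype ι] {p : ι → ℝ} (hp1 : ∑ i, p i = 1)
    (e : Fin 2 → ℝ) (η : ι → Fin 2 → ℝ) (ω t : ℝ) :
    ∑ i, (p i : ℂ) • (diagonal (fun a =>
        Complex.exp (-(Complex.I * t) * ((ω * e a + η i a : ℝ) : ℂ)))
      * ketbra (fun _ : Fin 2 => (((Real.sqrt 2)⁻¹ : ℝ) : ℂ))
      * (diagonal (fun a => Complex.exp (-(Complex.I * t) * ((ω * e a + η i a : ℝ) : ℂ))))ᴴ)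
    = coherenceState (Complex.exp (-(Complex.I * (t * (e 0 - e 1) : ℝ)) * ω)
        * charSum p (fun i => η i 0 - η i 1) t) := by
  have h : ((Real.sqrt 2)⁻¹ : ℂ) * ((Real.sqrt 2)⁻¹ : ℂ) = 1 / 2 := by
    rw [← mul_inv, ← Complex.ofReal_mul, Real.mul_self_sqrt zero_le_two, one_div]
    norm_num
  have hent : ∀ i a b, (diagonal (fun a =>
        Complex.exp (-(Complex.I * t) * ((ω * e a + η i a : ℝ) : ℂ)))
      * ketbra (fun _ : Fin 2 => (((Real.sqrt 2)⁻¹ : ℝ) : ℂ))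
      * (diagonal (fun a => Complex.exp (-(Complex.I * t) * ((ω * e a + η i a : ℝ) : ℂ))))ᴴ) a b
      = Complex.exp (-(Complex.I * t)
        * ((ω * (e a - e b) + (η i a - η i b) : ℝ) : ℂ)) / 2 := by
    intro i a b
    rw [diagonal_conjTranspose, mul_diagonal, diagonal_mul, ketbra, vecMulVec_apply]
    simp only [Pi.star_apply, Complex.star_def, Complex.conj_ofReal, ← Complex.exp_conj]
    rw [Complex.ofReal_inv, h, mul_right_comm, ← Complex.exp_add, mul_one_div]
    congr 2
    simp only [map_mul, map_neg, Complex.conj_I, Complex.conj_ofReal]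
    push_cast
    ring
  have hsum : ∀ a b, ∑ i, (p i : ℂ) * (Complex.exp (-(Complex.I * t)
        * ((ω * (e a - e b) + (η i a - η i b) : ℝ) : ℂ)) / 2)
      = Complex.exp (-(Complex.I * (t * (e a - e b) : ℝ)) * ω)
        * charSum p (fun i => η i a - η i b) t / 2 := by
    intro a b
    rw [charSum, Finset.mul_sum, Finset.sum_div]
    refine Finset.sum_congr rfl fun i _ => ?_
    rw [mul_left_comm, ← Complex.exp_add, mul_div_assoc]
    congr 3
    push_cast
    ring
  have hdiag : ∀ a, ∑ i, (p i : ℂ) * (Complex.exp (-(Complex.I * t)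
        * ((ω * (e a - e a) + (η i a - η i a) : ℝ) : ℂ)) / 2) = 1 / 2 := by
    intro a
    simp only [sub_self, mul_zero, add_zero, Complex.ofReal_zero, Complex.exp_zero]
    rw [← Finset.sum_mul, ← Complex.ofReal_sum, hp1, Complex.ofReal_one, one_mul]
  ext a b
  simp only [Matrix.sum_apply, Matrix.smul_apply, hent, smul_eq_mul]
  fin_cases a <;> fin_cases b
  · exact hdiag 0
  · exact hsum 0 1
  · have h10 : ∀ z, coherenceState z 1 0 = star z / 2 := fun _ => rfl
    refine (hsum 1 0).trans (Eq.trans ?_ (h10 _).symm)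
    simp only [charSum, star_mul', star_sum, Complex.star_def, ← Complex.exp_conj,
      map_mul, map_neg, Complex.conj_I, Complex.conj_ofReal]
    congr 2
    · congr 1; push_cast; ring
    · refine Finset.sum_congr rfl fun i _ => ?_
      congr 2; push_cast; ring
  · exact hdiag 1

end MainTheorem

theorem theorem3 {dE dP r : ℕ} (M : HMM dE dP r)
    (φ : OrthonormalBasis (Fin dE) ℂ (EuclideanSpace ℂ (Fin dE)))
    (hdiag : M.IsDiagonal φ) (hG : M.G ∉ M.lindbladSpan φ) :
    ∃ (dA : ℕ) (C : QECProtocol dP dA) (ψ : Fin C.d → ℂ),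
      star ψ ⬝ᵥ ψ = 1 ∧
      -- error correction reduces the joint dynamics to unitary ones
      (∀ ρ₀ : Op (EPA dE dP dA), IsDensity ρ₀ → IsEnvDiagonal φ ρ₀ →
        onRight dE C.proj * ρ₀ * onRight dE C.proj = ρ₀ →
        ∀ ω t : ℝ, 0 ≤ t →
          Filter.Tendsto (M.correctedState C ω t ρ₀) Filter.atTop
            (nhds (NormedSpace.exp ((-(Complex.I * t)) • M.effectiveHamiltonian C ω) * ρ₀
              * NormedSpace.exp ((Complex.I * t) • M.effectiveHamiltonian C ω)))) ∧
      -- scaling of the quantum Fisher information, for every initial state of the environment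
      (∀ ρE : Op (Fin dE), IsDensity ρE →
        ∃ (σ : ℝ → ℝ → Op (Fin dP × Fin dA)) (f : ℝ → ℝ),
          (∀ ω t : ℝ, 0 ≤ t →
            Filter.Tendsto
              (fun n => traceE (M.correctedState C ω t
                (Matrix.kronecker ρE (ketbra (C.enc.mulVec ψ))) n))
              Filter.atTop (nhds (σ t ω))) ∧
          (∀ ω t : ℝ, 0 ≤ t → ∀ a b, DifferentiableAt ℝ (fun w => σ t w a b) ω) ∧
          IsAlmostPeriodic f ∧
          (∀ ω t : ℝ, 0 ≤ t → qfi (σ t) ω = t ^ 2 * f t) ∧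
          (∀ ω : ℝ, 0 < Filter.limsup
            (fun t : ℝ => ((qfi (σ t) ω / t ^ 2 : ℝ) : EReal)) Filter.atTop)) := by
  have hstar := fun O => M.conjTranspose_mem_lindbladSpan φ (O := O)
  obtain ⟨A, hA, hA𝒮, hAG⟩ := exists_purifications
    (Submodule.subset_span (Or.inl (Or.inl (Or.inl rfl)))) hstar hG
  have hcomp := purifiedEnc_compress A
  set enc := purifiedEnc A
  have henc : enc.conjTranspose * enc = 1 := by
    have h := hcomp 1
    rw [Matrix.one_kronecker_one, Matrix.mul_one] at h
    rw [h]
    simp only [Matrix.one_mul, hA]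
    exact Matrix.diagonal_one
  have hscalar : ∀ O ∈ M.lindbladSpan φ, ∃ c : ℂ,
      enc.conjTranspose * (O ⊗ₖ (1 : Op (Fin (dP * 2)))) * enc = c • (1 : Op (Fin 2)) := by
    intro O hO
    refine ⟨(O * (A 0 * (A 0).conjTranspose)).trace, ?_⟩
    rw [hcomp, Matrix.smul_one_eq_diagonal]
    congr 1
    funext a
    fin_cases a
    · rfl
    · exact (hA𝒮 O hO).symm
  -- The errors are indexed by jump and branch together, so a single recovery serves all branches;
  -- this is where the products with `i ≠ m` in the span are needed.
  obtain ⟨m, R, h1, h2, hR⟩ := exists_corrects henc (ι := Fin r × Fin dE)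
    (F := fun l => block φ (M.L l.1) l.2 l.2 ⊗ₖ (1 : Op (Fin (dP * 2))))
    (fun l => hscalar _ (Submodule.subset_span (Or.inl (Or.inl (Or.inr ⟨l.1, l.2, rfl⟩)))))
    (fun l l' => by
      rw [Matrix.conjTranspose_kronecker, Matrix.conjTranspose_one, ← Matrix.mul_kronecker_mul,
        Matrix.one_mul, ← block_conjTranspose]
      exact hscalar _ (Submodule.subset_span (Or.inr ⟨l.1, l'.1, l.2, l'.2, rfl⟩)))
  set C : QECProtocol dP (dP * 2) := ⟨2, enc, henc, m, R, h1, h2⟩ with hCdef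
  have hC : ∀ k i, C.Corrects (block φ (M.L k) i i ⊗ₖ (1 : Op (Fin (dP * 2)))) :=
    fun k i => hR (k, i)
  refine ⟨dP * 2, C, fun _ => (((Real.sqrt 2)⁻¹ : ℝ) : ℂ), ?_, ?_, ?_⟩
  · exact star_dotProduct_uniformQubit
  · intro ρ _ hd hP ω t _
    exact tendsto_correctedState hdiag hC hd hP ω t
  intro ρE hρE
  obtain ⟨p, hp0, hp1, hp⟩ := exists_populations φ hρE
  set e : Op (Fin dP) → Fin 2 → ℝ := fun O a => (O * (A a * (A a).conjTranspose)).trace.re with he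
  have hreal : ∀ O : Op (Fin dP), O.IsHermitian → ∀ a,
      (O * (A a * (A a).conjTranspose)).trace = e O a := by
    intro O hO a
    refine (Complex.conj_eq_iff_re.1 ?_).symm
    rw [← Complex.star_def, ← Matrix.trace_conjTranspose, Matrix.conjTranspose_mul, hO.eq,
      Matrix.conjTranspose_mul, Matrix.conjTranspose_conjTranspose, Matrix.trace_mul_comm]
  have hblock : ∀ i, (block φ M.HEP i i).IsHermitian := fun i => by
    rw [Matrix.IsHermitian, ← block_conjTranspose, M.HEP_herm.eq]
  -- The gap of the encoded signal: the speed, in `ω t`, of the phase common to all branches. It is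
  -- nonzero by the choice of the witness.
  set g : ℝ := e M.G 0 - e M.G 1 with hg
  have hg0 : g ≠ 0 := fun h => hAG (by
    rw [hreal _ M.G_herm, hreal _ M.G_herm, sub_eq_zero.1 h])
  -- The additional frequency of the branch `i`, due to `HEP`. It does not depend on `ω`, so it
  -- affects only the visibility `charSum p δ t`.
  set δ : Fin dE → ℝ := fun i => e (block φ M.HEP i i) 0 - e (block φ M.HEP i i) 1 with hδ
  have hε : ∀ (ω : ℝ) i, C.enc.conjTranspose
      * (((ω : ℂ) • M.G + block φ M.HEP i i) ⊗ₖ (1 : Op (Fin (dP * 2)))) * C.enc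
      = Matrix.diagonal fun a => ((ω * e M.G a + e (block φ M.HEP i i) a : ℝ) : ℂ) := by
    intro ω i
    refine (hcomp _).trans (congrArg Matrix.diagonal (funext fun a => ?_))
    rw [Matrix.add_mul, Matrix.trace_add, Matrix.smul_mul, Matrix.trace_smul, hreal _ M.G_herm,
      hreal _ (hblock i)]
    push_cast
    rfl
  set z : ℝ → ℝ → ℂ := fun t ω => Complex.exp (-(Complex.I * (t * g : ℝ)) * ω) * charSum p δ t
    with hz
  have hzder : ∀ t ω, HasDerivAt (z t) (-(Complex.I * (t * g : ℝ)) * z t ω) ω := by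
    intro t ω
    have h := (((Complex.ofRealCLM.hasDerivAt (x := ω)).const_mul
      (-(Complex.I * (t * g : ℝ)))).cexp).mul_const (charSum p δ t)
    refine h.congr_deriv ?_
    simp only [hz, Complex.ofRealCLM_apply, Complex.ofReal_one]
    ring
  have hznorm : ∀ t ω, ‖z t ω‖ = ‖charSum p δ t‖ := by
    intro t ω
    rw [hz, norm_mul, Complex.norm_exp]
    simp
  have hqfi : ∀ t ω, qfi (fun w => enc * coherenceState (z t w) * enc.conjTranspose) ω
      = t ^ 2 * (g ^ 2 * ‖charSum p δ t‖ ^ 2) := by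
    intro t ω
    rw [(qfi_coherenceState henc (hzder t ω)).2, hznorm]
    ring
  have hap := isAlmostPeriodic_charSum hp0 hp1 δ g
  refine ⟨fun t ω => enc * coherenceState (z t ω) * enc.conjTranspose,
    fun t => g ^ 2 * ‖charSum p δ t‖ ^ 2, ?_, ?_, hap, ?_, ?_⟩
  · intro ω t _
    refine (tendsto_traceE_correctedState hdiag hC (hp _) (hε ω) _ t).trans_eq
      (congrArg nhds ?_)
    refine congrArg (fun X => enc * X * enc.conjTranspose) ?_
    exact sum_dephased_eq_coherenceState hp1 _ _ _ _
  · intro ω t _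
    exact (qfi_coherenceState henc (hzder t ω)).1
  · intro ω t _
    exact hqfi t ω
  · intro ω
    -- At time 0 all branches are in phase, so `f 0 = g ^ 2`.
    have hpos := hap.limsup_pos (by
      rw [charSum_zero hp1]
      simp only [norm_one, one_pow, mul_one]
      positivity)
    refine hpos.trans_eq (Filter.limsup_congr ?_)
    filter_upwards [Filter.eventually_gt_atTop (0 : ℝ)] with t ht
    rw [hqfi, mul_div_cancel_left₀ _ (by positivity)]
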